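/- **Theorem (Invariance Principle).** Let $\Omega$ be a finite set, let $n,\ell\ge 0$ be integers, and let $\mathcal P$ be a probability distribution on $\Omega^\ell$ all of whose $\ell$ one-dimensional marginals are equal to one distribution $\pi$ on $\Omega$, with $\min_{x\in\Omega}\pi(x)\ge\alpha>0$. All random variables below live on one probability space. *Ensembles.* An orthonormal ensemble of size $p$ is a tuple of real random variables $(Z_0\equiv 1,Z_1,\dots,Z_p)$ with $\mathbb E[Z_k^2]=1$ and $\mathbb E[Z_kZ_{k'}]=0$ for $k\ne k'$; it is Gaussian if $Z_1,\dots,Z_p$ are independent $\mathcal N(0,1)$. It is constructed from a random variable $X$ if its elements form an orthonormal basis of $L^2(X)$, the space of square-integrable random variables of the form $f(X)$. An ensemble sequence is a tuple $(Z_1,\dots,Z_n)$ of independent orthonormal ensembles of the same size; it is Gaussian if each $Z_i$ is. *Ensemble collection.* Let $X_i=(X_i^{(1)},\dots,X_i^{(\ell)})$, $i=1,\dots,n$, be independent with law $\mathcal P$. For each $j\in[\ell]$ let $\mathcal X^{(j)}=(\mathcal X^{(j)}_1,\dots,\mathcal X^{(j)}_n)$ be an ensemble sequence, with ensembles of size $p$,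 such that $\mathcal X^{(j)}_i$ is constructed from $X^{(j)}_i$ for each $i$, and let $\mathcal G^{(j)}=(\mathcal G^{(j)}_1,\dots,\mathcal G^{(j)}_n)$ be a Gaussian ensemble sequence with ensembles of size $p$. Assume that the $n$ families $(\mathcal G_i^{(1)},\dots,\mathcal G_i^{(\ell)})$, $i\in[n]$, are independent and that $$\operatorname{Cov}[\mathcal X^{(j_1)}_{i_1,k_1},\mathcal X^{(j_2)}_{i_2,k_2}]=\operatorname{Cov}[\mathcal G^{(j_1)}_{i_1,k_1},\mathcal G^{(j_2)}_{i_2,k_2}]\quad\text{for all } i_1,i_2,j_1,j_2,k_1,k_2.$$ *Polynomials.* For $j\in[\ell]$ let $P^{(j)}(x)=\sum_{\sigma\in\{0,\dots,p\}^n}c_j(\sigma)\prod_{i=1}^n x_{i,\sigma_i}$ with real coefficients. With $|\sigma|=\#\{i:\sigma_i\neq0\}$, put $\deg P^{(j)}=\max\{|\sigma|:c_j(\sigma)\ne0\}$ ($-\infty$ for the zero polynomial), $\operatorname{Var}[P^{(j)}]=\sum_{\sigma}c_j(\sigma)^2-c_j(0^n)^2$ and $\operatorname{Inf}_i(P^{(j)})=\sum_{\sigma:\sigma_i\ne0}c_j(\sigma)^2$.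 Let $d\in\mathbb N=\{0,1,2,\dots\}$ and $\tau\in[0,1]$, and assume that $\deg P^{(j)}\le d$ and $\operatorname{Var}[P^{(j)}]\le1$ for each $j\in[\ell]$, and $\sum_{j=1}^\ell\operatorname{Inf}_i(P^{(j)})\le\tau$ for each $i\in[n]$. *Conclusion.* Let $B\ge 0$ and let $\Psi:\mathbb R^\ell\to\mathbb R$ be $B$-smooth, i.e. $\Psi$ is $C^3$ and every third-order partial derivative of $\Psi$ is bounded by $B$ in absolute value everywhere. Write $\overline P(\mathcal X)=(P^{(1)}(\mathcal X^{(1)}),\dots,P^{(\ell)}(\mathcal X^{(\ell)}))$, and similarly $\overline P(\mathcal G)$. Then $\Psi(\overline P(\mathcal X))$ and $\Psi(\overline P(\mathcal G))$ are integrable and $$\bigl|\mathbb E\bigl[\Psi(\overline P(\mathcal X))-\Psi(\overline P(\mathcal G))\bigr]\bigr|\le\frac{\ell^{5/2}\,d\,B}{3}\Bigl(\frac{8}{\sqrt\alpha}\Bigr)^d\sqrt\tau .$$ -/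

import Mathlib

open MeasureTheory ProbabilityTheory

namespace InvariancePrinciple

noncomputable section

/-! Formal multilinear polynomials over `n` blocks of `p + 1` variables. -/

/-- A multilinear polynomial `∑ σ, c σ * ∏ i, x i (σ i)`, where `σ` runs over the tuples in
`{0, …, p} ^ n`. It is given by its family of coefficients `c`. -/
structure MultilinearPoly (n p : ℕ) where
  /-- The coefficient of the monomial `∏ i, x i (σ i)`. -/
  coeff : (Fin n → Fin (p + 1)) → ℝ

/-- The number of positions in which a tuple is nonzero (the size of its support). -/
def tupleDegree {n p : ℕ} (σ : Fin n → Fin (p + 1)) : ℕ :=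
  (Finset.univ.filter fun i => σ i ≠ 0).card

namespace MultilinearPoly

variable {n p : ℕ}

/-- Evaluation of a multilinear polynomial. -/
def eval (P : MultilinearPoly n p) (x : Fin n → Fin (p + 1) → ℝ) : ℝ :=
  ∑ σ, P.coeff σ * ∏ i, x i (σ i)

/-- The degree: the largest `tupleDegree σ` over all `σ` with nonzero coefficient, and `⊥` for the
zero polynomial. -/
def degree (P : MultilinearPoly n p) : WithBot ℕ :=
  (Finset.univ.filter fun σ => P.coeff σ ≠ 0).sup fun σ => (tupleDegree σ : WithBot ℕ)

/-- The formal expectation of a multilinear polynomial. -/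
def mean (P : MultilinearPoly n p) : ℝ := P.coeff 0

/-- The formal second moment of a multilinear polynomial. -/
def secondMoment (P : MultilinearPoly n p) : ℝ := ∑ σ, P.coeff σ ^ 2

/-- The formal variance of a multilinear polynomial. -/
def variance (P : MultilinearPoly n p) : ℝ := P.secondMoment - P.mean ^ 2

/-- The (formal) influence of coordinate `i` on a multilinear polynomial. -/
def influence (P : MultilinearPoly n p) (i : Fin n) : ℝ :=
  ∑ σ ∈ Finset.univ.filter (fun σ => σ i ≠ 0), P.coeff σ ^ 2

end MultilinearPoly

/-! Orthonormal ensembles. -/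

variable {S : Type*} [MeasurableSpace S]

/-- An orthonormal ensemble of size `p`: real random variables `Z 0 = 1, Z 1, …, Z p` with
`𝔼[Z k ^ 2] = 1` and `𝔼[Z k * Z k'] = 0` for `k ≠ k'`. (As `𝔼[Z k ^ 2] = 1 ≠ 0`, every `Z k` is
square-integrable.) -/
structure IsOrthonormalEnsemble {p : ℕ} (Z : Fin (p + 1) → S → ℝ) (μ : Measure S) : Prop where
  measurable : ∀ k, Measurable (Z k)
  zero_eq_one : ∀ s, Z 0 s = 1
  integral_sq : ∀ k, ∫ s, Z k s ^ 2 ∂μ = 1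
  integral_mul : ∀ k k', k ≠ k' → ∫ s, Z k s * Z k' s ∂μ = 0

/-- An ensemble sequence of size `n`: independent orthonormal ensembles of the same size `p`. -/
structure IsEnsembleSequence {n p : ℕ} (Z : Fin n → Fin (p + 1) → S → ℝ) (μ : Measure S) :
    Prop where
  ensemble : ∀ i, IsOrthonormalEnsemble (Z i) μ
  indep : iIndepFun (fun i s k => Z i k s) μ

/-- An orthonormal ensemble is Gaussian if `Z 1, …, Z p` are independent standard normals. -/
structure IsGaussianEnsemble {p : ℕ} (Z : Fin (p + 1) → S → ℝ) (μ : Measure S) : Prop where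
  ensemble : IsOrthonormalEnsemble Z μ
  law : ∀ k : Fin p, μ.map (Z k.succ) = gaussianReal 0 1
  indep : iIndepFun (fun k : Fin p => Z k.succ) μ

/-- An ensemble sequence is Gaussian if each of its ensembles is. -/
structure IsGaussianEnsembleSequence {n p : ℕ} (Z : Fin n → Fin (p + 1) → S → ℝ)
    (μ : Measure S) : Prop where
  sequence : IsEnsembleSequence Z μ
  gaussian : ∀ i, IsGaussianEnsemble (Z i) μ

/-- The space `L²(X)` of square-integrable real random variables of the form `f ∘ X`. -/
def L2Of {Ω : Type*} [MeasurableSpace Ω] (X : S → Ω) (μ : Measure S) : Submodule ℝ (S → ℝ) where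
  carrier := {Z | (∃ f : Ω → ℝ, Measurable f ∧ Z = f ∘ X) ∧ MemLp Z 2 μ}
  zero_mem' := ⟨⟨0, measurable_zero, rfl⟩, MemLp.zero⟩
  add_mem' := by
    rintro _ _ ⟨⟨f, hf, rfl⟩, hf'⟩ ⟨⟨g, hg, rfl⟩, hg'⟩
    exact ⟨⟨f + g, hf.add hg, rfl⟩, hf'.add hg'⟩
  smul_mem' := by
    rintro c _ ⟨⟨f, hf, rfl⟩, hf'⟩
    exact ⟨⟨c • f, hf.const_smul c, rfl⟩, hf'.const_smul c⟩

/-- An orthonormal ensemble is constructed from `X` if its elements form an orthonormal basis of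
`L²(X)`: they are orthonormal and their linear span is `L²(X)`. -/
structure IsConstructedFrom {Ω : Type*} [MeasurableSpace Ω] {p : ℕ}
    (Z : Fin (p + 1) → S → ℝ) (X : S → Ω) (μ : Measure S) : Prop where
  ensemble : IsOrthonormalEnsemble Z μ
  span_eq : Submodule.span ℝ (Set.range Z) = L2Of X μ

/-- An ensemble collection for the `n`-fold power of a distribution `P` on `Ω ^ ℓ`.
Here `X s i j` is the value at coordinate `i` and step `j`, and `𝒳 j i k`, `𝒢 j i k` are the
`k`-th elements of the `i`-th ensembles of the `j`-th sequences. -/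
structure IsEnsembleCollection {Ω : Type*} [MeasurableSpace Ω] {n ℓ p : ℕ}
    (P : Measure (Fin ℓ → Ω)) [IsProbabilityMeasure P]
    (X : S → Fin n → Fin ℓ → Ω)
    (𝒳 𝒢 : Fin ℓ → Fin n → Fin (p + 1) → S → ℝ) (μ : Measure S) : Prop where
  /-- `X` is a random vector with i.i.d. coordinates of law `P`. -/
  measurable : Measurable X
  law : μ.map X = Measure.pi fun _ : Fin n => P
  /-- For each step `j`, `𝒳 j` is an ensemble sequence constructed from the `j`-th step of `X`. -/
  sequence : ∀ j, IsEnsembleSequence (𝒳 j) μ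
  constructed : ∀ j i, IsConstructedFrom (𝒳 j i) (fun s => X s i j) μ
  /-- For each step `j`, `𝒢 j` is a Gaussian ensemble sequence. -/
  gaussian : ∀ j, IsGaussianEnsembleSequence (𝒢 j) μ
  /-- The coordinates of `𝒢`, each taken over all steps at once, are independent. -/
  gaussian_indep : iIndepFun (fun i s j k => 𝒢 j i k s) μ
  /-- The covariances of `𝒢` are those of `𝒳`. -/
  cov_eq : ∀ i₁ i₂ j₁ j₂ k₁ k₂,
    cov[𝒳 j₁ i₁ k₁, 𝒳 j₂ i₂ k₂; μ] = cov[𝒢 j₁ i₁ k₁, 𝒢 j₂ i₂ k₂; μ]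

/-- The tuple of random variables `(P⁽¹⁾(Z⁽¹⁾), …, P⁽ˡ⁾(Z⁽ˡ⁾))`, at the sample point `s`. -/
def evalTuple {n ℓ p : ℕ} (Q : Fin ℓ → MultilinearPoly n p)
    (Z : Fin ℓ → Fin n → Fin (p + 1) → S → ℝ) (s : S) : Fin ℓ → ℝ :=
  fun j => (Q j).eval fun i k => Z j i k s

/-- `Ψ : ℝ ^ ℓ → ℝ` is `B`-smooth: it is `C³` and all its third-order partial derivatives are
bounded by `B` in absolute value. -/
structure IsBSmooth {ℓ : ℕ} (B : ℝ) (Ψ : (Fin ℓ → ℝ) → ℝ) : Prop where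
  contDiff : ContDiff ℝ 3 Ψ
  bound : ∀ (j : Fin 3 → Fin ℓ) (x : Fin ℓ → ℝ),
    |iteratedFDeriv ℝ 3 Ψ x (fun m => Pi.single (j m) (1 : ℝ))| ≤ B

end

end InvariancePrinciple

open InvariancePrinciple

namespace InvariancePrinciple

/-! Third moments. -/

section ThirdMoments

variable {T : Type*} [MeasurableSpace T] {ν : Measure T}

/-! This is Lindeberg's replacement method combined with hypercontractivity. Both expectations
depend only on joint laws that are products over the coordinates, so everything moves to `Fin n →
S`, where coordinate `i` is read from its own copy of `S` and its ensembles can be exchanged without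
disturbing the others. With the other coordinates frozen, each polynomial is affine in block `i`. In
the expansion of `Ψ` to second order in that block, the terms of orders one and two have equal
expectations for both families, because the blocks are centred with equal covariances. Each of the
two remainders costs at most `B / 6` times the third moment of the ℓ¹-norm of the part depending on
block `i` (`abs_integral_replace_le`).

These third moments are controlled by the influences: a polynomial of degree at most `d` has L³-norm
at most `η⁻¹ ^ d` times the ℓ²-norm of its coefficients (`integral_sum_prod_pow_three_le`). By
induction on the number of blocks (`integral_noise_pow_three_le`) this reduces to a bound for one
block. That bound holds for `𝒳` because every atom has mass at least `α`, and for `𝒢` by Gaussian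
moments; `η ^ 3 = √α / 8` serves both.

Coordinate `i` thus costs `B / 3 * (8 / √α) ^ d` times the cube of the sum over `j` of the square
roots of the influences. By Cauchy–Schwarz and the bound `τ`, this cube is at most `ℓ ^ (3 / 2) *
√τ` times the summed influence at `i`. The total of all influences is at most `ℓ * d`, which
completes the factor `ℓ ^ (5 / 2) * d`. -/

theorem exists_nonneg_pow_three_eq {I : ℝ} (hI : 0 ≤ I) : ∃ m : ℝ, 0 ≤ m ∧ m ^ 3 = I := by
  refine ⟨I ^ (1 / 3 : ℝ), by positivity, ?_⟩
  rw [← Real.rpow_natCast, ← Real.rpow_mul hI]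
  norm_num

theorem integrable_abs_pow_three {F : T → ℝ} (hF : MemLp F 3 ν) :
    Integrable (fun t => |F t| ^ 3) ν := by
  have h : MemLp F ((3 : ℕ) : ENNReal) ν := by exact_mod_cast hF
  simpa using h.integrable_norm_pow (by norm_num)

theorem memLp_three_of_integrable {F : T → ℝ} (hF : AEStronglyMeasurable F ν)
    (h : Integrable (fun t => |F t| ^ 3) ν) : MemLp F 3 ν := by
  rw [← integrable_norm_rpow_iff hF (by norm_num) (by norm_num)]
  have : (3 : ENNReal).toReal = ((3 : ℕ) : ℝ) := by norm_num
  simpa only [this, Real.rpow_natCast, Real.norm_eq_abs] using h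

/-- Young's inequality with exponents 3 and 3/2; three times the gap factors as `(|x| - |y|) ^ 2 *
(|x| + 2 * |y|)`. -/
theorem abs_mul_sq_le_pow_three (x y : ℝ) : |x| * y ^ 2 ≤ |x| ^ 3 / 3 + 2 * |y| ^ 3 / 3 := by
  rw [← sq_abs y]
  nlinarith [mul_nonneg (sq_nonneg (|x| - |y|)) (by positivity : 0 ≤ |x| + 2 * |y|)]

theorem integrable_abs_mul_sq {F G : T → ℝ} (hF : MemLp F 3 ν) (hG : MemLp G 3 ν) :
    Integrable (fun t => |F t| * G t ^ 2) ν := by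
  refine Integrable.mono' (((integrable_abs_pow_three hF).div_const 3).add
    (((integrable_abs_pow_three hG).const_mul 2).div_const 3))
    ((by simpa using hF.1.norm : AEStronglyMeasurable (fun t => |F t|) ν).mul (hG.1.pow 2))
    (.of_forall fun t => ?_)
  rw [Real.norm_of_nonneg (by positivity)]
  exact abs_mul_sq_le_pow_three _ _

/-- Hölder's inequality with exponents `3` and `3 / 2`. -/
theorem integral_abs_mul_sq_le {F G : T → ℝ} (hF : MemLp F 3 ν) (hG : MemLp G 3 ν) {a b : ℝ}
    (ha : 0 ≤ a) (hb : 0 ≤ b) (hFa : ∫ t, |F t| ^ 3 ∂ν ≤ a ^ 3) (hGb : ∫ t, |G t| ^ 3 ∂ν ≤ b ^ 3) :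
    ∫ t, |F t| * G t ^ 2 ∂ν ≤ a * b ^ 2 := by
  -- Young's inequality is integrated for `F` and `G` normalised by their norm bounds. The shift by
  -- `ε` keeps the divisors positive when `a` or `b` vanishes and is removed by a limit.
  have key : ∀ ε > (0 : ℝ), ∫ t, |F t| * G t ^ 2 ∂ν ≤ (a + ε) * (b + ε) ^ 2 := by
    intro ε hε
    set A := a + ε
    set C := b + ε
    have hA : 0 < A := by positivity
    have hC : 0 < C := by positivity
    have hFA : ∫ t, |F t| ^ 3 ∂ν ≤ A ^ 3 := hFa.trans (by gcongr; simp [A, hε.le])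
    have hGC : ∫ t, |G t| ^ 3 ∂ν ≤ C ^ 3 := hGb.trans (by gcongr; simp [C, hε.le])
    have h1 : ∫ t, |F t| * G t ^ 2 ∂ν ≤
        ∫ t, (C ^ 2 / (3 * A ^ 2) * |F t| ^ 3 + 2 * A / (3 * C) * |G t| ^ 3) ∂ν := by
      refine integral_mono (integrable_abs_mul_sq hF hG)
        (((integrable_abs_pow_three hF).const_mul _).add
          ((integrable_abs_pow_three hG).const_mul _)) fun t => ?_
      have := mul_le_mul_of_nonneg_left (abs_mul_sq_le_pow_three (F t / A) (G t / C))
        (by positivity : 0 ≤ A * C ^ 2)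
      rw [abs_div, abs_div, abs_of_pos hA, abs_of_pos hC] at this
      calc |F t| * G t ^ 2 = A * C ^ 2 * (|F t| / A * (G t / C) ^ 2) := by field_simp
        _ ≤ _ := this
        _ = _ := by field_simp
    rw [integral_add ((integrable_abs_pow_three hF).const_mul _)
      ((integrable_abs_pow_three hG).const_mul _), integral_const_mul, integral_const_mul] at h1
    refine h1.trans ?_
    calc _ ≤ C ^ 2 / (3 * A ^ 2) * A ^ 3 + 2 * A / (3 * C) * C ^ 3 := by gcongr
      _ = A * C ^ 2 := by field_simp; ring
  have hlim : Filter.Tendsto (fun ε : ℝ => (a + ε) * (b + ε) ^ 2) (nhdsWithin 0 (Set.Ioi 0))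
      (nhds (a * b ^ 2)) := by
    have : Continuous fun ε : ℝ => (a + ε) * (b + ε) ^ 2 := by fun_prop
    simpa using (this.tendsto 0).mono_left nhdsWithin_le_nhds
  exact ge_of_tendsto hlim (Filter.eventually_of_mem self_mem_nhdsWithin key)

variable {ι : Type*} [Fintype ι]

theorem memLp_sum_abs {U : ι → T → ℝ} (hU : ∀ j, MemLp (U j) 3 ν) :
    MemLp (fun t => ∑ j, |U j t|) 3 ν :=
  memLp_finsetSum _ fun j _ => by simpa using (hU j).norm

/-- Minkowski's inequality in `L³`. -/
theorem integral_sum_abs_pow_three_le {U : ι → T → ℝ} (hU : ∀ j, MemLp (U j) 3 ν) {u : ι → ℝ}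
    (hu : ∀ j, 0 ≤ u j) (h : ∀ j, ∫ t, |U j t| ^ 3 ∂ν ≤ u j ^ 3) :
    ∫ t, (∑ j, |U j t|) ^ 3 ∂ν ≤ (∑ j, u j) ^ 3 := by
  have hF := memLp_sum_abs hU
  set F : T → ℝ := fun t => ∑ j, |U j t| with hFdef
  have hF0 : ∀ t, 0 ≤ F t := fun t => Finset.sum_nonneg fun j _ => abs_nonneg _
  obtain ⟨m, hm0, hm⟩ := exists_nonneg_pow_three_eq
    (integral_nonneg (μ := ν) fun t => pow_nonneg (hF0 t) 3)
  have hm' : ∫ t, |F t| ^ 3 ∂ν ≤ m ^ 3 := by simp only [abs_of_nonneg (hF0 _)]; exact hm.ge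
  have hu0 : 0 ≤ ∑ j, u j := Finset.sum_nonneg fun j _ => hu j
  -- Here `m` is the L³-norm of the sum. One factor of the cube is expanded, Hölder is applied to
  -- each term, and `m ^ 2` is cancelled.
  have key : m ^ 3 ≤ (∑ j, u j) * m ^ 2 := by
    calc m ^ 3 = ∫ t, ∑ j, |U j t| * F t ^ 2 ∂ν := by
          rw [hm]; congr 1; ext t; rw [← Finset.sum_mul]; ring
      _ = ∑ j, ∫ t, |U j t| * F t ^ 2 ∂ν :=
          integral_finsetSum _ fun j _ => integrable_abs_mul_sq (hU j) hF
      _ ≤ ∑ j, u j * m ^ 2 :=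
          Finset.sum_le_sum fun j _ => integral_abs_mul_sq_le (hU j) hF (hu j) hm0 (h j) hm'
      _ = _ := by rw [Finset.sum_mul]
  rw [← hm]
  gcongr
  rcases hm0.eq_or_lt with rfl | hpos
  · exact hu0
  · exact le_of_mul_le_mul_right (by linarith [pow_succ' m 2] : m * m ^ 2 ≤ _) (by positivity)

theorem memLp_sqrt_sum_sq {U : ι → T → ℝ} (hU : ∀ j, MemLp (U j) 3 ν) :
    MemLp (fun t => √(∑ j, U j t ^ 2)) 3 ν := by
  refine (memLp_sum_abs hU).mono ?_ (.of_forall fun t => ?_)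
  · refine Real.continuous_sqrt.comp_aestronglyMeasurable ?_
    exact Finset.aestronglyMeasurable_fun_sum _ fun j _ => (hU j).1.pow 2
  · rw [Real.norm_of_nonneg (by positivity), Real.norm_of_nonneg (by positivity)]
    refine Real.sqrt_le_iff.2 ⟨by positivity, ?_⟩
    simpa using Finset.sum_sq_le_sq_sum_of_nonneg (s := Finset.univ) (f := fun j => |U j t|)
      fun j _ => abs_nonneg _

/-- The triangle inequality in `L^(3/2)` for the squares. -/
theorem integral_sqrt_sum_sq_pow_three_le {U : ι → T → ℝ} (hU : ∀ j, MemLp (U j) 3 ν)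
    {u : ι → ℝ} (hu : ∀ j, 0 ≤ u j) (h : ∀ j, ∫ t, |U j t| ^ 3 ∂ν ≤ u j ^ 3) :
    ∫ t, √(∑ j, U j t ^ 2) ^ 3 ∂ν ≤ √(∑ j, u j ^ 2) ^ 3 := by
  have hF := memLp_sqrt_sum_sq hU
  set F : T → ℝ := fun t => √(∑ j, U j t ^ 2) with hFdef
  have hF0 : ∀ t, 0 ≤ F t := fun t => Real.sqrt_nonneg _
  obtain ⟨m, hm0, hm⟩ := exists_nonneg_pow_three_eq
    (integral_nonneg (μ := ν) fun t => pow_nonneg (hF0 t) 3)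
  have hm' : ∫ t, |F t| ^ 3 ∂ν ≤ m ^ 3 := by simp only [abs_of_nonneg (hF0 _)]; exact hm.ge
  have hu0 : 0 ≤ ∑ j, u j ^ 2 := by positivity
  -- The same duality argument, with the squared factor expanded instead, so that a single `m`
  -- cancels.
  have key : m ^ 3 ≤ m * ∑ j, u j ^ 2 := by
    calc m ^ 3 = ∫ t, ∑ j, |F t| * U j t ^ 2 ∂ν := by
          rw [hm]; congr 1; ext t
          rw [← Finset.mul_sum, abs_of_nonneg (hF0 t), pow_succ' _ 2,
            Real.sq_sqrt (by positivity : 0 ≤ ∑ j, U j t ^ 2)]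
      _ = ∑ j, ∫ t, |F t| * U j t ^ 2 ∂ν :=
          integral_finsetSum _ fun j _ => integrable_abs_mul_sq hF (hU j)
      _ ≤ ∑ j, m * u j ^ 2 :=
          Finset.sum_le_sum fun j _ => integral_abs_mul_sq_le hF (hU j) hm0 (hu j) hm' (h j)
      _ = _ := by rw [Finset.mul_sum]
  rw [← hm]
  gcongr
  rcases hm0.eq_or_lt with rfl | hpos
  · positivity
  · refine Real.le_sqrt_of_sq_le ?_
    exact le_of_mul_le_mul_left (by linarith [pow_succ' m 2] : m * m ^ 2 ≤ _) hpos

end ThirdMoments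

/-! ### Pointwise cubic inequalities behind hypercontractivity. -/

theorem abs_one_add_pow_three_le (x : ℝ) : |1 + x| ^ 3 ≤ 1 + 3 * x + 3 * x ^ 2 + |x| ^ 3 := by
  rcases le_total 0 (1 + x) with h | h
  · rw [abs_of_nonneg h]
    nlinarith [le_abs_self (x ^ 3), abs_pow x 3]
  · rw [abs_of_nonpos h, abs_of_nonpos (by linarith : x ≤ 0)]
    nlinarith [sq_nonneg (2 * x + 1)]

/-- Second-order expansion of the cubed absolute value at `a`. The linear term is exact in `x`, so
it integrates to zero when `x` is centred; only second and third moments then matter. The case `a =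
1` gives the rest by homogeneity. -/
theorem abs_add_pow_three_le (a x : ℝ) :
    |a + x| ^ 3 ≤ |a| ^ 3 + 3 * (a * |a|) * x + 3 * |a| * x ^ 2 + |x| ^ 3 := by
  rcases eq_or_ne a 0 with rfl | ha
  · simp
  have ha' : 0 < |a| := abs_pos.2 ha
  have h := mul_le_mul_of_nonneg_left (abs_one_add_pow_three_le (x / a))
    (by positivity : 0 ≤ |a| ^ 3)
  have e : |a + x| = |a| * |1 + x / a| := by rw [← abs_mul]; congr 1; field_simp
  rw [e, mul_pow]
  refine h.trans (le_of_eq ?_)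
  rw [abs_div]
  have h2 : |a| ^ 2 = a ^ 2 := sq_abs a
  have h3 : |a| ^ 3 = |a| * a ^ 2 := by rw [← h2]; ring
  have : |a| ^ 3 * (1 + 3 * (x / a) + 3 * (x / a) ^ 2 + (|x| / |a|) ^ 3)
      = |a| ^ 3 + 3 * |a| ^ 3 * (x / a) + 3 * |a| ^ 3 * (x / a) ^ 2 + |x| ^ 3 := by
    field_simp
  rw [this, h3]
  field_simp

/-- This closes the induction step for hypercontractivity. The `3 / 4` is `3 * (1 / 2) ^ 2`, from `η
≤ 1 / 2` in the quadratic term; the `1 / 4` is the constant in `IsHypercontractiveEnsemble`. -/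
theorem cubic_le_sqrt_pow_three {a s : ℝ} (ha : 0 ≤ a) (hs : 0 ≤ s) :
    a ^ 3 + 3 / 4 * (a * s ^ 2) + 1 / 4 * s ^ 3 ≤ √(a ^ 2 + s ^ 2) ^ 3 := by
  refine le_of_sq_le_sq ?_ (by positivity)
  rw [pow_right_comm, Real.sq_sqrt (by positivity)]
  nlinarith [mul_nonneg (pow_nonneg ha 2) (mul_nonneg (pow_nonneg hs 2) (sq_nonneg (a - s))),
    mul_nonneg (mul_nonneg ha (pow_nonneg hs 3)) (sq_nonneg (a - s)),
    mul_nonneg (pow_nonneg hs 4) (sq_nonneg (a - s)), pow_nonneg hs 6, pow_nonneg ha 6,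
    mul_nonneg (pow_nonneg ha 4) (pow_nonneg hs 2), mul_nonneg (pow_nonneg ha 2) (pow_nonneg hs 4)]

/-! Hypercontractivity. -/

/-- An orthonormal ensemble with third moments, whose centred linear combinations satisfy the
third moment bound that makes the ensemble `(2, 3, η)`-hypercontractive for `η ≤ 1 / 2`. -/
structure IsHypercontractiveEnsemble {S : Type*} [MeasurableSpace S] {p : ℕ} (η : ℝ)
    (z : Fin (p + 1) → S → ℝ) (μ : Measure S) : Prop where
  ensemble : IsOrthonormalEnsemble z μ
  memLp : ∀ k, MemLp (z k) 3 μ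
  integral_le : ∀ b : Fin p → ℝ,
    η ^ 3 * ∫ s, |∑ k, b k * z k.succ s| ^ 3 ∂μ ≤ 1 / 4 * √(∑ k, b k ^ 2) ^ 3

section Hypercontractivity

variable {S : Type*} [MeasurableSpace S] {μ : Measure S}

namespace IsOrthonormalEnsemble

variable {p : ℕ} {z : Fin (p + 1) → S → ℝ}

theorem memLp_two (hz : IsOrthonormalEnsemble z μ) (k : Fin (p + 1)) : MemLp (z k) 2 μ := by
  rw [memLp_two_iff_integrable_sq (hz.measurable k).aestronglyMeasurable]
  -- The integral of a non-integrable function is `0` by convention, which contradicts the value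
  -- `1`.
  by_contra h
  simpa [integral_undef h] using hz.integral_sq k

theorem integral_succ (hz : IsOrthonormalEnsemble z μ) (k : Fin p) :
    ∫ s, z k.succ s ∂μ = 0 := by
  simpa [hz.zero_eq_one] using hz.integral_mul k.succ 0 (Fin.succ_ne_zero k)

theorem integrable_mul (hz : IsOrthonormalEnsemble z μ) {z' : Fin (p + 1) → S → ℝ}
    (hz' : IsOrthonormalEnsemble z' μ) (k k' : Fin (p + 1)) :
    Integrable (fun s => z k s * z' k' s) μ :=
  (hz.memLp_two k).integrable_mul (hz'.memLp_two k')

theorem integral_sum_sq (hz : IsOrthonormalEnsemble z μ) (b : Fin p → ℝ) :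
    ∫ s, (∑ k, b k * z k.succ s) ^ 2 ∂μ = ∑ k, b k ^ 2 := by
  have e : ∀ s, (∑ k, b k * z k.succ s) ^ 2 =
      ∑ k, ∑ k', b k * b k' * (z k.succ s * z k'.succ s) := fun s => by
    rw [sq, Finset.sum_mul_sum]
    exact Finset.sum_congr rfl fun k _ => Finset.sum_congr rfl fun k' _ => by ring
  simp only [e]
  have hi : ∀ k k', Integrable (fun s => b k * b k' * (z k.succ s * z k'.succ s)) μ :=
    fun k k' => (hz.integrable_mul hz _ _).const_mul _
  rw [integral_finsetSum _ fun k _ => integrable_finsetSum _ fun k' _ => hi k k']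
  refine Finset.sum_congr rfl fun k _ => ?_
  rw [integral_finsetSum _ fun k' _ => hi k k', Finset.sum_eq_single k]
  · rw [integral_const_mul]
    have := hz.integral_sq k.succ
    simp only [sq] at this ⊢
    rw [this, mul_one]
  · intro k' _ hk
    rw [integral_const_mul, hz.integral_mul _ _ (by simpa using hk.symm), mul_zero]
  · simp

variable [IsProbabilityMeasure μ]

theorem integral_sum (hz : IsOrthonormalEnsemble z μ) (b : Fin p → ℝ) :
    ∫ s, ∑ k, b k * z k.succ s ∂μ = 0 := by
  rw [integral_finsetSum _ fun k _ =>
    ((hz.memLp_two k.succ).integrable (by norm_num)).const_mul (b k)]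
  simp [integral_const_mul, hz.integral_succ]

end IsOrthonormalEnsemble

namespace IsHypercontractiveEnsemble

variable {p : ℕ} {η : ℝ} {z : Fin (p + 1) → S → ℝ}

theorem memLp_sum (hz : IsHypercontractiveEnsemble η z μ) (b : Fin p → ℝ) :
    MemLp (fun s => ∑ k, b k * z k.succ s) 3 μ :=
  memLp_finsetSum _ fun k _ => (hz.memLp k.succ).const_mul (b k)

variable [IsProbabilityMeasure μ]

/-- Integrating the pointwise expansion, the linear term drops out because the ensemble is centred,
orthonormality evaluates the quadratic term, and the defining bound of the ensemble handles the
cubic one. -/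
theorem integral_abs_add_pow_three_le (hz : IsHypercontractiveEnsemble η z μ) (hη : 0 ≤ η)
    (hη' : η ≤ 1 / 2) (a : ℝ) (b : Fin p → ℝ) :
    ∫ s, |a + η * ∑ k, b k * z k.succ s| ^ 3 ∂μ ≤
      |a| ^ 3 + 3 / 4 * (|a| * √(∑ k, b k ^ 2) ^ 2) + 1 / 4 * √(∑ k, b k ^ 2) ^ 3 := by
  set g : S → ℝ := fun s => ∑ k, b k * z k.succ s with hg
  have hg3 : MemLp g 3 μ := hz.memLp_sum b
  have hg1 : Integrable g μ := hg3.integrable (by norm_num)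
  have hg2 : Integrable (fun s => g s ^ 2) μ := (hg3.mono_exponent (by norm_num)).integrable_sq
  have hg3' := integrable_abs_pow_three hg3
  have hL : Integrable (fun s => |a + η * g s| ^ 3) μ :=
    integrable_abs_pow_three ((memLp_const a).add (hg3.const_mul η))
  have h := integral_mono hL (((integrable_const (|a| ^ 3)).add
    (hg1.const_mul (3 * (a * |a|) * η))).add (hg2.const_mul (3 * |a| * η ^ 2)) |>.add
    (hg3'.const_mul (η ^ 3))) (fun s => show |a + η * g s| ^ 3 ≤
      |a| ^ 3 + 3 * (a * |a|) * η * g s + 3 * |a| * η ^ 2 * g s ^ 2 + η ^ 3 * |g s| ^ 3 by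
        refine (abs_add_pow_three_le _ _).trans (le_of_eq ?_)
        rw [abs_mul, abs_of_nonneg hη]; ring)
  rw [integral_add' (by fun_prop) (hg3'.const_mul (η ^ 3)),
    integral_add' (by fun_prop) (by fun_prop),
    integral_add' (by fun_prop) (by fun_prop), integral_const_mul, integral_const_mul,
    integral_const_mul, hz.ensemble.integral_sum b, hz.ensemble.integral_sum_sq b] at h
  rw [Real.sq_sqrt (by positivity)]
  have h3 := hz.integral_le b
  have h4 : 3 * |a| * η ^ 2 * ∑ k, b k ^ 2 ≤ 3 / 4 * (|a| * ∑ k, b k ^ 2) := by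
    have : η ^ 2 ≤ (1 / 2) ^ 2 := by gcongr
    have := mul_le_mul_of_nonneg_left this (by positivity : 0 ≤ 3 * (|a| * ∑ k, b k ^ 2))
    linarith
  simp only [integral_const, probReal_univ, one_smul, mul_zero, add_zero] at h
  linarith

end IsHypercontractiveEnsemble

theorem tupleDegree_cons_zero {n p : ℕ} (σ : Fin n → Fin (p + 1)) :
    tupleDegree (Fin.cons 0 σ : Fin (n + 1) → Fin (p + 1)) = tupleDegree σ := by
  simp [tupleDegree, Finset.card_filter, Fin.sum_univ_succ]

theorem tupleDegree_cons_succ {n p : ℕ} (k : Fin p) (σ : Fin n → Fin (p + 1)) :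
    tupleDegree (Fin.cons k.succ σ : Fin (n + 1) → Fin (p + 1)) = tupleDegree σ + 1 := by
  simp [tupleDegree, Finset.card_filter, Fin.sum_univ_succ, add_comm]

theorem sum_tuple_succ {n p : ℕ} (f : (Fin (n + 1) → Fin (p + 1)) → ℝ) :
    ∑ σ, f σ = ∑ σ, f (Fin.cons 0 σ) + ∑ k : Fin p, ∑ σ, f (Fin.cons k.succ σ) := by
  rw [← (Fin.consEquiv fun _ : Fin (n + 1) => Fin (p + 1)).sum_comp, Fintype.sum_prod_type,
    Fin.sum_univ_succ]
  rfl

variable [IsProbabilityMeasure μ]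

theorem memLp_pi_prod {n : ℕ} {f : Fin n → S → ℝ} (hf : ∀ i, MemLp (f i) 3 μ) :
    MemLp (fun s : Fin n → S => ∏ i, f i (s i)) 3 (Measure.pi fun _ => μ) := by
  refine memLp_three_of_integrable ?_ ?_
  · refine Finset.aestronglyMeasurable_fun_prod _ fun i _ => ?_
    exact (hf i).1.comp_quasiMeasurePreserving
      (Measure.quasiMeasurePreserving_eval (fun _ : Fin n => μ) i)
  · simp only [Finset.abs_prod, ← Finset.prod_pow]
    exact Integrable.fintype_prod (f := fun i x => |f i x| ^ 3)
      fun i => integrable_abs_pow_three (hf i)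

theorem memLp_sum_prod {n p : ℕ} {z : Fin n → Fin (p + 1) → S → ℝ}
    (hz : ∀ i k, MemLp (z i k) 3 μ) (c : (Fin n → Fin (p + 1)) → ℝ) :
    MemLp (fun s : Fin n → S => ∑ σ, c σ * ∏ i, z i (σ i) (s i)) 3 (Measure.pi fun _ => μ) :=
  memLp_finsetSum _ fun σ _ => (memLp_pi_prod fun i => hz i (σ i)).const_mul _

/-- The `(2, 3)`-hypercontractive inequality for independent hypercontractive ensembles. -/
theorem integral_noise_pow_three_le {p : ℕ} {η : ℝ} (hη : 0 ≤ η) (hη' : η ≤ 1 / 2) {n : ℕ}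
    {z : Fin n → Fin (p + 1) → S → ℝ} (hz : ∀ i, IsHypercontractiveEnsemble η (z i) μ)
    (c : (Fin n → Fin (p + 1)) → ℝ) :
    ∫ s : Fin n → S, |∑ σ, c σ * η ^ tupleDegree σ * ∏ i, z i (σ i) (s i)| ^ 3
      ∂Measure.pi (fun _ => μ) ≤ √(∑ σ, c σ ^ 2) ^ 3 := by
  induction n with
  | zero => simp [tupleDegree, Real.sqrt_sq_eq_abs]
  | succ n ih =>
    -- Block `0` is split off: with the other coordinates fixed at `s`, the polynomial is `A s + η *
    -- ∑ k, C k s * z 0 k.succ t`. The extra `η` appears because a tuple that is nonzero at position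
    -- `0` has degree one higher than its tail. Integration over `t` comes first; the induction
    -- hypothesis then bounds `A` and each `C k`.
    set A : (Fin n → S) → ℝ := fun s => ∑ σ, c (Fin.cons 0 σ) * η ^ tupleDegree σ *
      ∏ i, z (Fin.succ i) (σ i) (s i) with hA
    set C : Fin p → (Fin n → S) → ℝ := fun k s => ∑ σ, c (Fin.cons k.succ σ) *
      η ^ tupleDegree σ * ∏ i, z (Fin.succ i) (σ i) (s i) with hC
    have hA3 : MemLp A 3 (Measure.pi fun _ => μ) :=
      memLp_sum_prod (fun i k => (hz i.succ).memLp k) _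
    have hC3 : ∀ k, MemLp (C k) 3 (Measure.pi fun _ => μ) := fun k =>
      memLp_sum_prod (fun i k => (hz i.succ).memLp k) _
    have hAle := ih (fun i => hz i.succ) fun σ => c (Fin.cons 0 σ)
    have hCle := fun k : Fin p => ih (fun i => hz i.succ) fun σ => c (Fin.cons k.succ σ)
    have hFint := integrable_abs_pow_three (memLp_sum_prod (μ := μ) (fun i k => (hz i).memLp k)
      fun σ => c σ * η ^ tupleDegree σ)
    have hmp := (measurePreserving_piFinSuccAbove (fun _ : Fin (n + 1) => μ) 0).symm
    have hev : ∀ t s, ∑ σ, c σ * η ^ tupleDegree σ *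
        ∏ i, z i (σ i) ((MeasurableEquiv.piFinSuccAbove (fun _ => S) 0).symm (t, s) i) =
        A s + η * ∑ k, C k s * z 0 k.succ t := by
      intro t s
      rw [sum_tuple_succ]
      congr 1
      · refine Finset.sum_congr rfl fun σ _ => ?_
        simp [MeasurableEquiv.piFinSuccAbove_symm_apply, Fin.insertNthEquiv, Fin.prod_univ_succ,
          tupleDegree_cons_zero, (hz 0).ensemble.zero_eq_one]
      · rw [Finset.mul_sum]
        refine Finset.sum_congr rfl fun k _ => ?_
        rw [hC, Finset.sum_mul, Finset.mul_sum]
        refine Finset.sum_congr rfl fun σ _ => ?_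
        simp only [MeasurableEquiv.piFinSuccAbove_symm_apply, Fin.insertNthEquiv,
          Fin.prod_univ_succ, tupleDegree_cons_succ, Equiv.coe_fn_mk, Fin.insertNth_zero,
          Fin.cons_zero, Fin.cons_succ, pow_succ, cast_eq]
        ring
    rw [← hmp.integrable_comp_emb (MeasurableEquiv.measurableEmbedding _)] at hFint
    rw [← hmp.integral_comp']
    have hFint' : Integrable (fun x : S × (Fin n → S) =>
        |A x.2 + η * ∑ k, C k x.2 * z 0 k.succ x.1| ^ 3) (μ.prod (Measure.pi fun _ => μ)) := by
      simpa only [← hev, Function.comp_def] using hFint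
    have hint : ∫ x : S × (Fin n → S), |∑ σ, c σ * η ^ tupleDegree σ *
        ∏ i, z i (σ i) ((MeasurableEquiv.piFinSuccAbove (fun _ => S) 0).symm x i)| ^ 3
        ∂(μ.prod (Measure.pi fun _ => μ)) = ∫ x : S × (Fin n → S),
        |A x.2 + η * ∑ k, C k x.2 * z 0 k.succ x.1| ^ 3 ∂(μ.prod (Measure.pi fun _ => μ)) := by
      simp only [← hev]
    refine hint.trans_le ?_
    rw [integral_prod_symm _ hFint']
    set β : (Fin n → S) → ℝ := fun s => √(∑ k, C k s ^ 2) with hβ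
    have hβ3 : MemLp β 3 (Measure.pi fun _ => μ) := memLp_sqrt_sum_sq hC3
    have hβ0 : ∀ s, 0 ≤ β s := fun s => Real.sqrt_nonneg _
    set a := √(∑ σ, c (Fin.cons 0 σ) ^ 2) with ha
    set b : Fin p → ℝ := fun k => √(∑ σ, c (Fin.cons k.succ σ) ^ 2) with hb
    -- The triangle inequality in L^(3/2) merges the bounds for the separate `C k` into one for
    -- their Euclidean norm.
    have hβle : ∫ s, |β s| ^ 3 ∂(Measure.pi fun _ => μ) ≤ √(∑ k, b k ^ 2) ^ 3 := by
      simp only [abs_of_nonneg (hβ0 _)]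
      exact integral_sqrt_sum_sq_pow_three_le hC3 (fun k => Real.sqrt_nonneg _) hCle
    have hI1 := integrable_abs_pow_three hA3
    have hI2 := integrable_abs_mul_sq hA3 hβ3
    have hI3 := integrable_abs_pow_three hβ3
    calc _ ≤ ∫ s, (|A s| ^ 3 + 3 / 4 * (|A s| * β s ^ 2) + 1 / 4 * |β s| ^ 3)
          ∂(Measure.pi fun _ => μ) := by
          refine integral_mono hFint'.integral_prod_right
            ((hI1.add (hI2.const_mul _)).add (hI3.const_mul _)) fun s => ?_
          rw [abs_of_nonneg (hβ0 s)]
          exact (hz 0).integral_abs_add_pow_three_le hη hη' (A s) fun k => C k s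
      _ = ∫ s, |A s| ^ 3 ∂(Measure.pi fun _ => μ) +
          3 / 4 * ∫ s, |A s| * β s ^ 2 ∂(Measure.pi fun _ => μ) +
          1 / 4 * ∫ s, |β s| ^ 3 ∂(Measure.pi fun _ => μ) := by
          rw [integral_add (by fun_prop) (by fun_prop), integral_add (by fun_prop) (by fun_prop),
            integral_const_mul, integral_const_mul]
      _ ≤ a ^ 3 + 3 / 4 * (a * √(∑ k, b k ^ 2) ^ 2) + 1 / 4 * √(∑ k, b k ^ 2) ^ 3 := by
          gcongr
          exact integral_abs_mul_sq_le hA3 hβ3 (Real.sqrt_nonneg _) (Real.sqrt_nonneg _) hAle hβle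
      _ ≤ √(a ^ 2 + √(∑ k, b k ^ 2) ^ 2) ^ 3 :=
          cubic_le_sqrt_pow_three (Real.sqrt_nonneg _) (Real.sqrt_nonneg _)
      _ = _ := by
          congr 2
          rw [Real.sq_sqrt (by positivity), Real.sq_sqrt (by positivity), sum_tuple_succ]
          congr 1
          exact Finset.sum_congr rfl fun k _ => Real.sq_sqrt (by positivity)

/-- Third moments of multilinear polynomials of degree at most `d`. -/
theorem integral_sum_prod_pow_three_le {p : ℕ} {η : ℝ} (hη : 0 < η) (hη' : η ≤ 1 / 2) {n : ℕ}
    {z : Fin n → Fin (p + 1) → S → ℝ} (hz : ∀ i, IsHypercontractiveEnsemble η (z i) μ)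
    {c : (Fin n → Fin (p + 1)) → ℝ} {d : ℕ} (hd : ∀ σ, c σ ≠ 0 → tupleDegree σ ≤ d) :
    ∫ s : Fin n → S, |∑ σ, c σ * ∏ i, z i (σ i) (s i)| ^ 3 ∂Measure.pi (fun _ => μ) ≤
      ((η⁻¹) ^ d * √(∑ σ, c σ ^ 2)) ^ 3 := by
  -- The coefficients are inflated by `η⁻¹ ^ tupleDegree σ` so that the noise cancels; the degree
  -- bound limits the inflation to `η⁻¹ ^ d`.
  have h := integral_noise_pow_three_le hη.le hη' hz fun σ => c σ * (η⁻¹) ^ tupleDegree σ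
  have e : ∀ σ, c σ * (η⁻¹) ^ tupleDegree σ * η ^ tupleDegree σ = c σ := fun σ => by
    rw [mul_assoc, ← mul_pow, inv_mul_cancel₀ hη.ne', one_pow, mul_one]
  simp only [e] at h
  refine h.trans ?_
  gcongr
  refine Real.sqrt_le_iff.2 ⟨by positivity, ?_⟩
  rw [mul_pow, Real.sq_sqrt (by positivity), Finset.mul_sum]
  refine Finset.sum_le_sum fun σ _ => ?_
  rcases eq_or_ne (c σ) 0 with h0 | h0
  · simp [h0]
  · rw [mul_pow, mul_comm]
    gcongr
    · exact (one_le_inv₀ hη).2 (by linarith)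
    · exact hd σ h0

end Hypercontractivity

/-! Smooth test functions. -/

section Smooth

variable {ℓ : ℕ}

/-- Expansion in the standard basis reduces directional derivatives to the partial derivatives that
`IsBSmooth` controls, and expectations of forms to mixed moments. -/
theorem multilinear_apply_const {m : ℕ} (f : (Fin ℓ → ℝ) [×m]→L[ℝ] ℝ) (u : Fin ℓ → ℝ) :
    f (fun _ => u) =
      ∑ r : Fin m → Fin ℓ, (∏ i, u (r i)) * f fun i => Pi.single (r i) (1 : ℝ) := by
  have hu : u = ∑ j, u j • (Pi.single j (1 : ℝ) : Fin ℓ → ℝ) := pi_eq_sum_univ' u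
  conv_lhs => rw [hu]
  rw [f.map_sum]
  exact Finset.sum_congr rfl fun r _ => by rw [f.map_smul_univ, smul_eq_mul]

theorem iteratedDeriv_comp_line {Ψ : (Fin ℓ → ℝ) → ℝ} (hΨ : ContDiff ℝ 3 Ψ) (x u : Fin ℓ → ℝ)
    {m : ℕ} (hm : m ≤ 3) (t : ℝ) :
    iteratedDeriv m (fun t : ℝ => Ψ (x + t • u)) t =
      iteratedFDeriv ℝ m Ψ (x + t • u) fun _ => u := by
  set g : ℝ →L[ℝ] (Fin ℓ → ℝ) := (ContinuousLinearMap.id ℝ ℝ).smulRight u with hg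
  have hgt : ∀ t, g t = t • u := fun t => by simp [hg]
  have hΨ' : ContDiff ℝ 3 fun y => Ψ (x + y) := hΨ.comp (contDiff_const.add contDiff_id)
  have h := g.iteratedFDeriv_comp_right hΨ' t (i := m) (by exact_mod_cast hm)
  rw [iteratedDeriv_eq_iteratedFDeriv]
  have e : (fun t : ℝ => Ψ (x + t • u)) = (fun y => Ψ (x + y)) ∘ g := by ext t; simp [hgt]
  rw [e, h, iteratedFDeriv_comp_add_left, hgt]
  simp [hgt]

/-- The third-order Taylor remainder of `Ψ` at `x`. -/
noncomputable def taylorRemainder (Ψ : (Fin ℓ → ℝ) → ℝ) (x u : Fin ℓ → ℝ) : ℝ :=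
  Ψ (x + u) - Ψ x - iteratedFDeriv ℝ 1 Ψ x (fun _ => u) -
    1 / 2 * iteratedFDeriv ℝ 2 Ψ x fun _ => u

variable {B : ℝ} {Ψ : (Fin ℓ → ℝ) → ℝ}

theorem IsBSmooth.abs_iteratedFDeriv_three_le (hΨ : IsBSmooth B Ψ) (x u : Fin ℓ → ℝ) :
    |iteratedFDeriv ℝ 3 Ψ x fun _ => u| ≤ B * (∑ j, |u j|) ^ 3 := by
  rw [multilinear_apply_const]
  calc _ ≤ ∑ r : Fin 3 → Fin ℓ, (∏ i, |u (r i)|) * B := by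
        refine (Finset.abs_sum_le_sum_abs _ _).trans (Finset.sum_le_sum fun r _ => ?_)
        rw [abs_mul, Finset.abs_prod]
        gcongr
        exact hΨ.bound r x
    _ = _ := by
        rw [← Finset.sum_mul, mul_comm, ← Fintype.piFinset_univ,
          Finset.sum_prod_piFinset Finset.univ fun (_ : Fin 3) j => |u j|]
        simp

/-- Taylor's formula with Lagrange remainder for `t ↦ Ψ (x + t • u)` on `[0, 1]`; the `6` is `3!`.
-/
theorem IsBSmooth.abs_taylorRemainder_le (hΨ : IsBSmooth B Ψ) (x u : Fin ℓ → ℝ) :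
    |taylorRemainder Ψ x u| ≤ B / 6 * (∑ j, |u j|) ^ 3 := by
  have hφ : ContDiff ℝ 3 fun t : ℝ => Ψ (x + t • u) :=
    hΨ.contDiff.comp (contDiff_const.add (contDiff_id.smul contDiff_const))
  obtain ⟨t, -, ht⟩ := taylor_mean_remainder_lagrange_iteratedDeriv (x₀ := 0) (x := 1) (n := 2)
    zero_ne_one (f := fun t : ℝ => Ψ (x + t • u)) (by exact_mod_cast hφ.contDiffOn)
  have hd : UniqueDiffOn ℝ (Set.uIcc (0 : ℝ) 1) := uniqueDiffOn_uIcc zero_ne_one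
  have hw : ∀ m : ℕ, m ≤ 3 → iteratedDerivWithin m (fun t : ℝ => Ψ (x + t • u))
      (Set.uIcc 0 1) 0 = iteratedFDeriv ℝ m Ψ x fun _ => u := fun m hm => by
    rw [iteratedDerivWithin_eq_iteratedDeriv hd
      ((hφ.of_le (by exact_mod_cast hm)).contDiffAt) Set.left_mem_uIcc,
      iteratedDeriv_comp_line hΨ.contDiff x u hm]
    simp
  rw [taylorWithinEval_succ, taylorWithinEval_succ, taylor_within_zero_eval,
    hw _ (by norm_num), hw _ (by norm_num), iteratedDeriv_comp_line hΨ.contDiff x u le_rfl] at ht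
  have h3 := hΨ.abs_iteratedFDeriv_three_le (x + t • u) u
  have e : taylorRemainder Ψ x u = (iteratedFDeriv ℝ 3 Ψ (x + t • u) fun _ => u) / 6 := by
    have h6 : ((Nat.factorial (2 + 1) : ℕ) : ℝ) = 6 := by norm_num [Nat.factorial]
    rw [h6] at ht
    norm_num at ht
    rw [taylorRemainder]
    linarith
  rw [e, abs_div, abs_of_pos (by norm_num : (0 : ℝ) < 6)]
  linarith

variable {T : Type*} [MeasurableSpace T] {ν : Measure T}

theorem integrable_multilinear {m : ℕ} (f : (Fin ℓ → ℝ) [×m]→L[ℝ] ℝ) {U : Fin ℓ → T → ℝ}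
    (hU : ∀ r : Fin m → Fin ℓ, Integrable (fun t => ∏ i, U (r i) t) ν) :
    Integrable (fun t => f fun _ j => U j t) ν := by
  simp only [multilinear_apply_const f fun j => U j _]
  exact integrable_finsetSum _ fun r _ => (hU r).mul_const _

theorem integral_multilinear_eq {m : ℕ} (f : (Fin ℓ → ℝ) [×m]→L[ℝ] ℝ) {U V : Fin ℓ → T → ℝ}
    (hU : ∀ r : Fin m → Fin ℓ, Integrable (fun t => ∏ i, U (r i) t) ν)
    (hV : ∀ r : Fin m → Fin ℓ, Integrable (fun t => ∏ i, V (r i) t) ν)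
    (h : ∀ r : Fin m → Fin ℓ, ∫ t, ∏ i, U (r i) t ∂ν = ∫ t, ∏ i, V (r i) t ∂ν) :
    ∫ t, f (fun _ j => U j t) ∂ν = ∫ t, f (fun _ j => V j t) ∂ν := by
  simp only [multilinear_apply_const f fun j => U j _, multilinear_apply_const f fun j => V j _]
  rw [integral_finsetSum _ fun r _ => (hU r).mul_const _,
    integral_finsetSum _ fun r _ => (hV r).mul_const _]
  simp only [integral_mul_const, h]

theorem integrable_sum_abs_pow_three {U : Fin ℓ → T → ℝ} (hU : ∀ j, MemLp (U j) 3 ν) :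
    Integrable (fun t => (∑ j, |U j t|) ^ 3) ν := by
  refine (integrable_abs_pow_three (memLp_sum_abs hU)).congr (.of_forall fun t => ?_)
  simp only
  rw [abs_of_nonneg (Finset.sum_nonneg fun j _ => abs_nonneg _)]

theorem IsBSmooth.integrable_taylorRemainder (hΨ : IsBSmooth B Ψ) {U : Fin ℓ → T → ℝ}
    (hU : ∀ j, MemLp (U j) 3 ν) (x : Fin ℓ → ℝ) :
    Integrable (fun t => taylorRemainder Ψ x fun j => U j t) ν := by
  have hm : AEStronglyMeasurable (fun t j => U j t) ν :=
    (aemeasurable_pi_lambda _ fun j => (hU j).1.aemeasurable).aestronglyMeasurable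
  refine Integrable.mono' ((integrable_sum_abs_pow_three hU).const_mul (B / 6)) ?_
    (.of_forall fun t => hΨ.abs_taylorRemainder_le x _)
  refine Continuous.comp_aestronglyMeasurable
    (g := fun u => taylorRemainder Ψ x u) ?_ hm
  have := hΨ.contDiff.continuous
  unfold taylorRemainder
  fun_prop

variable [IsFiniteMeasure ν]

theorem integrable_prod_one {U : Fin ℓ → T → ℝ} (hU : ∀ j, MemLp (U j) 3 ν)
    (r : Fin 1 → Fin ℓ) : Integrable (fun t => ∏ i, U (r i) t) ν := by
  simpa using (hU (r 0)).integrable (by norm_num)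

theorem integrable_prod_two {U : Fin ℓ → T → ℝ} (hU : ∀ j, MemLp (U j) 3 ν)
    (r : Fin 2 → Fin ℓ) : Integrable (fun t => ∏ i, U (r i) t) ν := by
  have h : ∀ j, MemLp (U j) 2 ν := fun j => (hU j).mono_exponent (by norm_num)
  simp only [Fin.prod_univ_two]
  exact (h (r 0)).integrable_mul (h (r 1))

/-- Bounded third derivatives force at most cubic growth, so third moments suffice. -/
theorem IsBSmooth.integrable_add (hΨ : IsBSmooth B Ψ) {U : Fin ℓ → T → ℝ}
    (hU : ∀ j, MemLp (U j) 3 ν) (x : Fin ℓ → ℝ) :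
    Integrable (fun t => Ψ (x + fun j => U j t)) ν := by
  have h1 := integrable_multilinear (iteratedFDeriv ℝ 1 Ψ x) (integrable_prod_one hU)
  have h2 := integrable_multilinear (iteratedFDeriv ℝ 2 Ψ x) (integrable_prod_two hU)
  refine ((((hΨ.integrable_taylorRemainder hU x).add (integrable_const (Ψ x))).add h1).add
    (h2.const_mul (1 / 2))).congr (.of_forall fun t => ?_)
  simp only [Pi.add_apply, taylorRemainder]
  ring

theorem IsBSmooth.integrable_comp (hΨ : IsBSmooth B Ψ) {U : Fin ℓ → T → ℝ}
    (hU : ∀ j, MemLp (U j) 3 ν) : Integrable (fun t => Ψ fun j => U j t) ν := by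
  simpa using hΨ.integrable_add hU 0

/-- Two perturbations with matching first and second moments. -/
theorem IsBSmooth.abs_integral_sub_le (hΨ : IsBSmooth B Ψ) {U V : Fin ℓ → T → ℝ}
    (hU : ∀ j, MemLp (U j) 3 ν) (hV : ∀ j, MemLp (V j) 3 ν)
    (h1 : ∀ j, ∫ t, U j t ∂ν = ∫ t, V j t ∂ν)
    (h2 : ∀ j j', ∫ t, U j t * U j' t ∂ν = ∫ t, V j t * V j' t ∂ν) (x : Fin ℓ → ℝ) :
    |∫ t, (Ψ (x + fun j => U j t) - Ψ (x + fun j => V j t)) ∂ν| ≤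
      B / 6 * ∫ t, (∑ j, |U j t|) ^ 3 ∂ν + B / 6 * ∫ t, (∑ j, |V j t|) ^ 3 ∂ν := by
  -- The first- and second-order Taylor terms are fixed forms in the perturbation, so matching
  -- moments cancels them and only the two remainders survive.
  have e1 := integral_multilinear_eq (iteratedFDeriv ℝ 1 Ψ x) (integrable_prod_one hU)
    (integrable_prod_one hV) fun r => by simpa using h1 (r 0)
  have e2 := integral_multilinear_eq (iteratedFDeriv ℝ 2 Ψ x) (integrable_prod_two hU)
    (integrable_prod_two hV) fun r => by simpa [Fin.prod_univ_two] using h2 (r 0) (r 1)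
  have hsplit : ∀ {W : Fin ℓ → T → ℝ}, (∀ j, MemLp (W j) 3 ν) →
      ∫ t, Ψ (x + fun j => W j t) ∂ν = ∫ t, taylorRemainder Ψ x (fun j => W j t) ∂ν +
        ∫ _, Ψ x ∂ν + ∫ t, iteratedFDeriv ℝ 1 Ψ x (fun _ j => W j t) ∂ν +
        1 / 2 * ∫ t, iteratedFDeriv ℝ 2 Ψ x (fun _ j => W j t) ∂ν := by
    intro W hW
    have hW1 := integrable_multilinear (iteratedFDeriv ℝ 1 Ψ x) (integrable_prod_one hW)
    have hW2 := integrable_multilinear (iteratedFDeriv ℝ 2 Ψ x) (integrable_prod_two hW)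
    have hWr := hΨ.integrable_taylorRemainder hW x
    have hc := integrable_const (μ := ν) (Ψ x)
    rw [← integral_const_mul, ← integral_add' hWr hc, ← integral_add' (hWr.add hc) hW1,
      ← integral_add' ((hWr.add hc).add hW1) (hW2.const_mul _)]
    congr 1
    ext t
    simp only [taylorRemainder, Pi.add_apply]
    ring
  have hrem : ∀ {W : Fin ℓ → T → ℝ}, (∀ j, MemLp (W j) 3 ν) →
      |∫ t, taylorRemainder Ψ x (fun j => W j t) ∂ν| ≤ B / 6 * ∫ t, (∑ j, |W j t|) ^ 3 ∂ν := by
    intro W hW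
    rw [← integral_const_mul]
    exact abs_integral_le_integral_abs.trans
      (integral_mono (hΨ.integrable_taylorRemainder hW x).abs
        ((integrable_sum_abs_pow_three hW).const_mul _) fun t => hΨ.abs_taylorRemainder_le x _)
  rw [integral_sub (hΨ.integrable_add hU x) (hΨ.integrable_add hV x), hsplit hU, hsplit hV, e1, e2]
  calc _ = |∫ t, taylorRemainder Ψ x (fun j => U j t) ∂ν -
        ∫ t, taylorRemainder Ψ x (fun j => V j t) ∂ν| := by congr 1; ring
    _ ≤ _ := (abs_sub _ _).trans (add_le_add (hrem hU) (hrem hV))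

end Smooth

/-! Replacing one coordinate. -/

namespace MultilinearPoly

variable {n p : ℕ}

/-- The coefficient of `x i k` in a multilinear polynomial, as a polynomial in the other blocks. -/
noncomputable def slice (P : MultilinearPoly n p) (i : Fin n) (k : Fin (p + 1))
    (x : Fin n → Fin (p + 1) → ℝ) : ℝ :=
  ∑ σ with σ i = k, P.coeff σ * ∏ i' ∈ Finset.univ.erase i, x i' (σ i')

theorem eval_eq_sum_slice (P : MultilinearPoly n p) (i : Fin n) (x : Fin n → Fin (p + 1) → ℝ) :
    P.eval x = ∑ k, P.slice i k x * x i k := by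
  rw [eval, ← Finset.sum_fiberwise Finset.univ fun σ : Fin n → Fin (p + 1) => σ i]
  refine Finset.sum_congr rfl fun k _ => ?_
  rw [slice, Finset.sum_mul]
  refine Finset.sum_congr rfl fun σ hσ => ?_
  rw [← Finset.mul_prod_erase _ _ (Finset.mem_univ i), (Finset.mem_filter.1 hσ).2]
  ring

theorem slice_congr (P : MultilinearPoly n p) (i : Fin n) (k : Fin (p + 1))
    {x x' : Fin n → Fin (p + 1) → ℝ} (h : ∀ i', i' ≠ i → x i' = x' i') :
    P.slice i k x = P.slice i k x' := by
  refine Finset.sum_congr rfl fun σ _ => ?_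
  congr 1
  exact Finset.prod_congr rfl fun i' hi' => by rw [h i' (Finset.ne_of_mem_erase hi')]

/-- The part of a multilinear polynomial that depends on the `i`-th block. -/
noncomputable def dependentPart (P : MultilinearPoly n p) (i : Fin n) : MultilinearPoly n p where
  coeff σ := if σ i ≠ 0 then P.coeff σ else 0

theorem sum_sq_dependentPart (P : MultilinearPoly n p) (i : Fin n) :
    ∑ σ, (P.dependentPart i).coeff σ ^ 2 = P.influence i := by
  rw [influence, Finset.sum_filter]
  exact Finset.sum_congr rfl fun σ _ => by simp only [dependentPart]; split_ifs <;> simp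

theorem slice_dependentPart_zero (P : MultilinearPoly n p) (i : Fin n)
    (x : Fin n → Fin (p + 1) → ℝ) : (P.dependentPart i).slice i 0 x = 0 :=
  Finset.sum_eq_zero fun σ hσ => by simp [dependentPart, (Finset.mem_filter.1 hσ).2]

theorem slice_dependentPart_succ (P : MultilinearPoly n p) (i : Fin n) (k : Fin p)
    (x : Fin n → Fin (p + 1) → ℝ) :
    (P.dependentPart i).slice i k.succ x = P.slice i k.succ x :=
  Finset.sum_congr rfl fun σ hσ => by
    simp [dependentPart, (Finset.mem_filter.1 hσ).2, Fin.succ_ne_zero]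

theorem eval_dependentPart (P : MultilinearPoly n p) (i : Fin n) (x : Fin n → Fin (p + 1) → ℝ) :
    (P.dependentPart i).eval x = ∑ k : Fin p, P.slice i k.succ x * x i k.succ := by
  rw [eval_eq_sum_slice _ i, Fin.sum_univ_succ]
  simp [slice_dependentPart_zero, slice_dependentPart_succ]

theorem tupleDegree_le_of_degree_le {P : MultilinearPoly n p} {d : ℕ}
    (h : P.degree ≤ (d : WithBot ℕ)) (σ : Fin n → Fin (p + 1)) (hσ : P.coeff σ ≠ 0) :
    tupleDegree σ ≤ d := by
  exact_mod_cast Finset.sup_le_iff.1 h σ (by simp [hσ])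

end MultilinearPoly

/-! ### Resampling one coordinate of a product measure. -/

section Update

variable {S : Type*} [MeasurableSpace S] {μ : Measure S} [IsProbabilityMeasure μ] {n : ℕ}

/-- Overwriting one coordinate by an independent copy preserves the law. It suffices to check boxes:
the preimage of a box leaves the old coordinate `i` free and constrains the new one instead. -/
theorem measurePreserving_update (i : Fin n) :
    MeasurePreserving (fun x : (Fin n → S) × S => Function.update x.1 i x.2)
      ((Measure.pi fun _ => μ).prod μ) (Measure.pi fun _ => μ) := by
  have hm : Measurable fun x : (Fin n → S) × S => Function.update x.1 i x.2 := by
    refine measurable_pi_lambda _ fun i' => ?_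
    rcases eq_or_ne i' i with rfl | h
    · simpa using measurable_snd
    · simp only [Function.update_of_ne h]
      exact (measurable_pi_apply i').comp measurable_fst
  refine ⟨hm, (Measure.pi_eq fun t ht => ?_).symm⟩
  rw [Measure.map_apply hm (MeasurableSet.univ_pi ht)]
  have e : (fun x : (Fin n → S) × S => Function.update x.1 i x.2) ⁻¹' Set.univ.pi t =
      (Set.univ.pi (Function.update t i Set.univ)) ×ˢ t i := by
    ext ⟨s, y⟩
    simp only [Set.mem_preimage, Set.mem_pi, Set.mem_univ, true_implies, Set.mem_prod]
    constructor
    · refine fun h => ⟨fun i' => ?_, by simpa using h i⟩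
      rcases eq_or_ne i' i with rfl | hi
      · simp
      · simpa [hi] using h i'
    · rintro ⟨h, hy⟩ i'
      rcases eq_or_ne i' i with rfl | hi
      · simpa using hy
      · simpa [hi] using h i'
  rw [e, Measure.prod_prod, Measure.pi_pi, ← Finset.mul_prod_erase _ _ (Finset.mem_univ i),
    ← Finset.mul_prod_erase (a := i) _ _ (Finset.mem_univ i)]
  simp only [Function.update_self, measure_univ, one_mul]
  rw [mul_comm]
  congr 1
  exact Finset.prod_congr rfl fun i' hi' => by
    rw [Function.update_of_ne (Finset.ne_of_mem_erase hi')]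

theorem integrable_update {F : (Fin n → S) → ℝ} (hF : Integrable F (Measure.pi fun _ => μ))
    (i : Fin n) :
    Integrable (fun x : (Fin n → S) × S => F (Function.update x.1 i x.2))
      ((Measure.pi fun _ => μ).prod μ) :=
  (measurePreserving_update i).integrable_comp_of_integrable hF

theorem integral_eq_integral_update {F : (Fin n → S) → ℝ}
    (hF : Integrable F (Measure.pi fun _ => μ)) (i : Fin n) :
    ∫ s, F s ∂Measure.pi (fun _ => μ) =
      ∫ s, ∫ t, F (Function.update s i t) ∂μ ∂Measure.pi (fun _ => μ) := by
  rw [← integral_prod _ (integrable_update hF i)]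
  have h := measurePreserving_update (μ := μ) i
  rw [← integral_map h.measurable.aemeasurable (by rw [h.map_eq]; exact hF.1), h.map_eq]

end Update

/-! ### Lindeberg replacement on the product space. -/

section Replacement

variable {S : Type*} [MeasurableSpace S] {μ : Measure S} [IsProbabilityMeasure μ] {n ℓ p : ℕ}
  {η : ℝ}

/-- The family on the product space whose `i`-th ensembles read the `i`-th coordinate. -/
def productFamily (Z : Fin ℓ → Fin n → Fin (p + 1) → S → ℝ) :
    Fin ℓ → Fin n → Fin (p + 1) → (Fin n → S) → ℝ :=
  fun j i k s => Z j i k (s i)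

theorem memLp_eval_productFamily {Z : Fin ℓ → Fin n → Fin (p + 1) → S → ℝ}
    (hZ : ∀ j i, IsHypercontractiveEnsemble η (Z j i) μ) (P : MultilinearPoly n p) (j : Fin ℓ) :
    MemLp (fun s => P.eval fun i k => productFamily Z j i k s) 3 (Measure.pi fun _ => μ) :=
  memLp_sum_prod (fun i k => (hZ j i).memLp k) _

theorem integrable_comp_evalTuple {B : ℝ} {Ψ : (Fin ℓ → ℝ) → ℝ} (hΨ : IsBSmooth B Ψ)
    {Z : Fin ℓ → Fin n → Fin (p + 1) → S → ℝ}
    (hZ : ∀ j i, IsHypercontractiveEnsemble η (Z j i) μ) (Q : Fin ℓ → MultilinearPoly n p) :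
    Integrable (fun s => Ψ (evalTuple Q (productFamily Z) s)) (Measure.pi fun _ => μ) :=
  hΨ.integrable_comp (U := fun j s => (Q j).eval fun i k => productFamily Z j i k s)
    fun j => memLp_eval_productFamily hZ (Q j) j

/-- Hypercontractivity applies to each dependent part, whose squared coefficients sum to the
influence; Minkowski's inequality then combines the `ℓ` components. -/
theorem integral_sum_dependentPart_le (hη : 0 < η) (hη' : η ≤ 1 / 2)
    {Z : Fin ℓ → Fin n → Fin (p + 1) → S → ℝ}
    (hZ : ∀ j i, IsHypercontractiveEnsemble η (Z j i) μ) {Q : Fin ℓ → MultilinearPoly n p}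
    {d : ℕ} (hd : ∀ j, (Q j).degree ≤ (d : WithBot ℕ)) (i : Fin n) :
    ∫ s, (∑ j, |((Q j).dependentPart i).eval fun i k => productFamily Z j i k s|) ^ 3
      ∂Measure.pi (fun _ => μ) ≤ ((η⁻¹) ^ d * ∑ j, √((Q j).influence i)) ^ 3 := by
  rw [Finset.mul_sum]
  refine integral_sum_abs_pow_three_le (fun j => memLp_eval_productFamily hZ _ j)
    (fun j => by positivity) fun j => ?_
  have h := integral_sum_prod_pow_three_le hη hη' (hZ j) (d := d)
    (c := ((Q j).dependentPart i).coeff) fun σ hσ => by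
      refine MultilinearPoly.tupleDegree_le_of_degree_le (hd j) σ fun h => hσ ?_
      simp [MultilinearPoly.dependentPart, h]
  rwa [MultilinearPoly.sum_sq_dependentPart] at h

/-- The cost of replacing the ensembles at one coordinate by ensembles with the same second
moments. -/
theorem abs_integral_replace_le (hη : 0 < η) (hη' : η ≤ 1 / 2) {B : ℝ} (hB : 0 ≤ B)
    {Ψ : (Fin ℓ → ℝ) → ℝ} (hΨ : IsBSmooth B Ψ) {Z Z' : Fin ℓ → Fin n → Fin (p + 1) → S → ℝ}
    (hZ : ∀ j i, IsHypercontractiveEnsemble η (Z j i) μ)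
    (hZ' : ∀ j i, IsHypercontractiveEnsemble η (Z' j i) μ) {Q : Fin ℓ → MultilinearPoly n p}
    {d : ℕ} (hd : ∀ j, (Q j).degree ≤ (d : WithBot ℕ)) (i : Fin n)
    (hne : ∀ j i', i' ≠ i → Z j i' = Z' j i')
    (hcov : ∀ j j' (k k' : Fin p), ∫ s, Z j i k.succ s * Z j' i k'.succ s ∂μ =
      ∫ s, Z' j i k.succ s * Z' j' i k'.succ s ∂μ) :
    |∫ s, Ψ (evalTuple Q (productFamily Z) s) ∂Measure.pi (fun _ => μ) -
      ∫ s, Ψ (evalTuple Q (productFamily Z') s) ∂Measure.pi (fun _ => μ)| ≤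
      B / 3 * ((η⁻¹) ^ d * ∑ j, √((Q j).influence i)) ^ 3 := by
  -- The coefficients `b` and the constant part `R` involve only coordinates other than `i`, where
  -- `Z` and `Z'` agree, so the same `b` and `R` serve both families.
  set b : (Fin n → S) → Fin ℓ → Fin p → ℝ := fun s j k =>
    (Q j).slice i k.succ fun i k => productFamily Z j i k s with hb
  set R : (Fin n → S) → Fin ℓ → ℝ := fun s j =>
    (Q j).slice i 0 fun i k => productFamily Z j i k s with hR
  have hslice : ∀ {Y : Fin ℓ → Fin n → Fin (p + 1) → S → ℝ}, (∀ j i', i' ≠ i → Y j i' = Z j i') →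
      ∀ j k s t, ((Q j).slice i k fun i' k => productFamily Y j i' k (Function.update s i t)) =
        (Q j).slice i k fun i' k => productFamily Z j i' k s := by
    intro Y hY j k s t
    refine MultilinearPoly.slice_congr _ _ _ fun i' hi' => ?_
    ext k'
    simp [productFamily, hi', hY j i' hi']
  have heval : ∀ {Y : Fin ℓ → Fin n → Fin (p + 1) → S → ℝ},
      (∀ j i, IsHypercontractiveEnsemble η (Y j i) μ) → (∀ j i', i' ≠ i → Y j i' = Z j i') →
      ∀ s t, evalTuple Q (productFamily Y) (Function.update s i t) =
        R s + fun j => ∑ k, b s j k * Y j i k.succ t := by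
    intro Y hYh hY s t
    ext j
    rw [evalTuple, MultilinearPoly.eval_eq_sum_slice _ i, Fin.sum_univ_succ]
    simp only [hslice hY, hb, hR, Pi.add_apply]
    simp [productFamily, (hYh j i).ensemble.zero_eq_one]
  have hdep : ∀ {Y : Fin ℓ → Fin n → Fin (p + 1) → S → ℝ}, (∀ j i', i' ≠ i → Y j i' = Z j i') →
      ∀ s t j, (((Q j).dependentPart i).eval fun i' k =>
        productFamily Y j i' k (Function.update s i t)) = ∑ k, b s j k * Y j i k.succ t := by
    intro Y hY s t j
    rw [MultilinearPoly.eval_dependentPart]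
    simp only [hslice hY, hb]
    simp [productFamily]
  have hself : ∀ j i', i' ≠ i → Z j i' = Z j i' := fun _ _ _ => rfl
  have hne' : ∀ j i', i' ≠ i → Z' j i' = Z j i' := fun j i' h => (hne j i' h).symm
  -- The perturbation at coordinate `i` is the evaluation of the dependent part, so averaging over
  -- the frozen coordinates returns to the third-moment bound on the whole product space.
  have hcube : ∀ {Y : Fin ℓ → Fin n → Fin (p + 1) → S → ℝ},
      (∀ j i, IsHypercontractiveEnsemble η (Y j i) μ) → (∀ j i', i' ≠ i → Y j i' = Z j i') →
      Integrable (fun s => ∫ t, (∑ j, |∑ k, b s j k * Y j i k.succ t|) ^ 3 ∂μ)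
        (Measure.pi fun _ => μ) ∧
      ∫ s, ∫ t, (∑ j, |∑ k, b s j k * Y j i k.succ t|) ^ 3 ∂μ ∂Measure.pi (fun _ => μ) ≤
        ((η⁻¹) ^ d * ∑ j, √((Q j).influence i)) ^ 3 := by
    intro Y hYh hY
    have hI := integrable_sum_abs_pow_three fun j =>
      memLp_eval_productFamily hYh ((Q j).dependentPart i) j
    have hle := integral_sum_dependentPart_le hη hη' hYh hd i
    rw [integral_eq_integral_update hI i] at hle
    have hI' := (integrable_update hI i).integral_prod_left
    simp only [hdep hY] at hle hI'
    exact ⟨hI', hle⟩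
  have hinner : ∀ s, |∫ t, (Ψ (R s + fun j => ∑ k, b s j k * Z j i k.succ t) -
      Ψ (R s + fun j => ∑ k, b s j k * Z' j i k.succ t)) ∂μ| ≤
      B / 6 * ∫ t, (∑ j, |∑ k, b s j k * Z j i k.succ t|) ^ 3 ∂μ +
      B / 6 * ∫ t, (∑ j, |∑ k, b s j k * Z' j i k.succ t|) ^ 3 ∂μ := by
    intro s
    have hprod : ∀ {Y : Fin ℓ → Fin n → Fin (p + 1) → S → ℝ},
        (∀ j i, IsHypercontractiveEnsemble η (Y j i) μ) → ∀ j j',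
        ∫ t, (∑ k, b s j k * Y j i k.succ t) * (∑ k, b s j' k * Y j' i k.succ t) ∂μ =
        ∑ k, ∑ k', b s j k * b s j' k' * ∫ t, Y j i k.succ t * Y j' i k'.succ t ∂μ := by
      intro Y hYh j j'
      have hI : ∀ k k' : Fin p, Integrable (fun t => b s j k * b s j' k' *
          (Y j i k.succ t * Y j' i k'.succ t)) μ := fun k k' =>
        ((hYh j i).ensemble.integrable_mul (hYh j' i).ensemble _ _).const_mul _
      simp only [← integral_const_mul]
      simp only [← integral_finsetSum _ fun k' _ => hI _ k']
      rw [← integral_finsetSum _ fun k _ => integrable_finsetSum _ fun k' _ => hI k k']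
      congr 1
      ext t
      rw [Finset.sum_mul_sum]
      exact Finset.sum_congr rfl fun k _ => Finset.sum_congr rfl fun k' _ => by ring
    refine hΨ.abs_integral_sub_le (fun j => (hZ j i).memLp_sum _)
      (fun j => (hZ' j i).memLp_sum _) (fun j => ?_) (fun j j' => ?_) (R s)
    · rw [(hZ j i).ensemble.integral_sum, (hZ' j i).ensemble.integral_sum]
    · rw [hprod hZ, hprod hZ']
      simp only [hcov]
  have hI := integrable_comp_evalTuple hΨ hZ Q
  have hI' := integrable_comp_evalTuple hΨ hZ' Q
  obtain ⟨hc1, hc2⟩ := hcube hZ hself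
  obtain ⟨hc1', hc2'⟩ := hcube hZ' hne'
  rw [← integral_sub' hI hI', integral_eq_integral_update (hI.sub hI') i]
  simp only [Pi.sub_apply, heval hZ hself, heval hZ' hne']
  refine abs_integral_le_integral_abs.trans ?_
  have hJ := (integrable_update (hI.sub hI') i).integral_prod_left
  simp only [Pi.sub_apply, heval hZ hself, heval hZ' hne'] at hJ
  refine (integral_mono hJ.abs ((hc1.const_mul (B / 6)).add (hc1'.const_mul (B / 6)))
    hinner).trans ?_
  rw [integral_add' (hc1.const_mul _) (hc1'.const_mul _), integral_const_mul, integral_const_mul]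
  have h1 := mul_le_mul_of_nonneg_left hc2 (by positivity : 0 ≤ B / 6)
  have h2 := mul_le_mul_of_nonneg_left hc2' (by positivity : 0 ≤ B / 6)
  linarith

/-- The Lindeberg replacement argument, for the families on the product space. -/
theorem abs_integral_sub_le_sum (hη : 0 < η) (hη' : η ≤ 1 / 2) {B : ℝ} (hB : 0 ≤ B)
    {Ψ : (Fin ℓ → ℝ) → ℝ} (hΨ : IsBSmooth B Ψ) {Z Z' : Fin ℓ → Fin n → Fin (p + 1) → S → ℝ}
    (hZ : ∀ j i, IsHypercontractiveEnsemble η (Z j i) μ)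
    (hZ' : ∀ j i, IsHypercontractiveEnsemble η (Z' j i) μ) {Q : Fin ℓ → MultilinearPoly n p}
    {d : ℕ} (hd : ∀ j, (Q j).degree ≤ (d : WithBot ℕ))
    (hcov : ∀ i j j' (k k' : Fin p), ∫ s, Z j i k.succ s * Z j' i k'.succ s ∂μ =
      ∫ s, Z' j i k.succ s * Z' j' i k'.succ s ∂μ) :
    |∫ s, Ψ (evalTuple Q (productFamily Z) s) ∂Measure.pi (fun _ => μ) -
      ∫ s, Ψ (evalTuple Q (productFamily Z') s) ∂Measure.pi (fun _ => μ)| ≤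
      ∑ i, B / 3 * ((η⁻¹) ^ d * ∑ j, √((Q j).influence i)) ^ 3 := by
  -- Hybrid families: coordinates in `A` are already replaced. Inserting one index into `A` changes
  -- a single coordinate, and the costs add up.
  set H : Finset (Fin n) → Fin ℓ → Fin n → Fin (p + 1) → S → ℝ :=
    fun A j i => if i ∈ A then Z' j i else Z j i with hH
  have hHh : ∀ A j i, IsHypercontractiveEnsemble η (H A j i) μ := fun A j i => by
    simp only [hH]; split_ifs
    exacts [hZ' j i, hZ j i]
  have key : ∀ A : Finset (Fin n),
      |∫ s, Ψ (evalTuple Q (productFamily Z) s) ∂Measure.pi (fun _ => μ) -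
        ∫ s, Ψ (evalTuple Q (productFamily (H A)) s) ∂Measure.pi (fun _ => μ)| ≤
        ∑ i ∈ A, B / 3 * ((η⁻¹) ^ d * ∑ j, √((Q j).influence i)) ^ 3 := by
    intro A
    induction A using Finset.induction_on with
    | empty => simp [hH]
    | insert i A hi ih =>
      rw [Finset.sum_insert hi, add_comm]
      refine (abs_sub_le _ _ _).trans (add_le_add ih ?_)
      refine abs_integral_replace_le hη hη' hB hΨ (hHh _) (hHh _) hd i
        (fun j i' hi' => by simp [hH, hi']) fun j j' k k' => ?_
      simp only [hH, hi, if_false, Finset.mem_insert_self, if_true]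
      exact hcov i j j' k k'
  have huniv : H Finset.univ = Z' := by ext; simp [hH]
  simpa only [huniv] using key Finset.univ

end Replacement

/-! Ensembles over finite probability spaces and Gaussian ensembles. -/

section Discrete

/-- The atom at `x` alone contributes at least `α * f x ^ 2` to the second moment. -/
theorem abs_le_of_le_real_singleton {Ω : Type*} [MeasurableSpace Ω] [Finite Ω]
    [DiscreteMeasurableSpace Ω] {π : Measure Ω} [IsFiniteMeasure π] {α : ℝ} (hα : 0 < α)
    (hmin : ∀ x : Ω, α ≤ π.real {x}) (f : Ω → ℝ) (x : Ω) :
    |f x| ≤ √(∫ y, f y ^ 2 ∂π) / √α := by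
  have h : π.real {x} * f x ^ 2 ≤ ∫ y, f y ^ 2 ∂π := by
    have := setIntegral_le_integral (s := {x}) (μ := π) (f := fun y => f y ^ 2)
      Integrable.of_finite (.of_forall fun y => sq_nonneg (f y))
    rwa [integral_singleton, smul_eq_mul] at this
  rw [le_div_iff₀ (Real.sqrt_pos.2 hα), ← Real.sqrt_sq_eq_abs, ← Real.sqrt_mul (sq_nonneg _)]
  refine Real.sqrt_le_sqrt (le_trans ?_ h)
  rw [mul_comm]
  exact mul_le_mul_of_nonneg_right (hmin x) (sq_nonneg _)

/-- The third moment is at most the sup norm times the second moment, and the sup norm is at most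
the L²-norm divided by `√α`. Multiplication by `η ^ 3` cancels `√α` and leaves `1 / 8`, within the
allowed `1 / 4`. -/
theorem IsConstructedFrom.isHypercontractiveEnsemble {S Ω : Type*} [MeasurableSpace S]
    [MeasurableSpace Ω] [Finite Ω] [DiscreteMeasurableSpace Ω] {μ : Measure S}
    [IsProbabilityMeasure μ] {π : Measure Ω} [IsProbabilityMeasure π] {α : ℝ} (hα : 0 < α)
    (hmin : ∀ x : Ω, α ≤ π.real {x}) {η : ℝ} (hη : η ^ 3 = √α / 8) {p : ℕ}
    {Z : Fin (p + 1) → S → ℝ} {Y : S → Ω} (hZ : IsConstructedFrom Z Y μ) (hY : Measurable Y)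
    (hlaw : μ.map Y = π) : IsHypercontractiveEnsemble η Z μ := by
  have hmem : ∀ k, ∃ f : Ω → ℝ, Measurable f ∧ Z k = f ∘ Y := fun k => by
    have : Z k ∈ L2Of Y μ := hZ.span_eq ▸ Submodule.subset_span (Set.mem_range_self k)
    exact this.1
  choose f hf hZf using hmem
  have hbound : ∀ (g : Ω → ℝ) s, |g (Y s)| ≤ √(∫ s, g (Y s) ^ 2 ∂μ) / √α := fun g s => by
    have h := abs_le_of_le_real_singleton hα hmin g (Y s)
    rwa [← hlaw, integral_map hY.aemeasurable
      (Measurable.of_discrete (f := fun y => g y ^ 2)).aestronglyMeasurable] at h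
  have hmemLp : ∀ k, MemLp (Z k) 3 μ := fun k => by
    rw [hZf k]
    exact MemLp.of_bound ((hf k).comp hY).aestronglyMeasurable _ (.of_forall fun s =>
      hbound (f k) s)
  refine ⟨hZ.ensemble, hmemLp, fun b => ?_⟩
  have hsq := hZ.ensemble.integral_sum_sq b
  have hg3 : MemLp (fun s => ∑ k, b k * Z k.succ s) 3 μ :=
    memLp_finsetSum _ fun k _ => (hmemLp k.succ).const_mul (b k)
  have hb : ∀ s, |∑ k, b k * Z k.succ s| ≤ √(∑ k, b k ^ 2) / √α := fun s => by
    have h := hbound (fun x => ∑ k : Fin p, b k * f k.succ x) s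
    have e : ∀ s (k : Fin p), f k.succ (Y s) = Z k.succ s := fun s k => by rw [hZf]; rfl
    simpa only [e, hsq] using h
  have hle : ∫ s, |∑ k, b k * Z k.succ s| ^ 3 ∂μ ≤
      √(∑ k, b k ^ 2) / √α * ∑ k, b k ^ 2 := by
    rw [← hsq, ← integral_const_mul, hsq]
    refine integral_mono (integrable_abs_pow_three hg3)
      ((hg3.mono_exponent (by norm_num)).integrable_sq.const_mul _) fun s => ?_
    simp only
    rw [pow_succ' _ 2, sq_abs]
    exact mul_le_mul_of_nonneg_right (hb s) (sq_nonneg _)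
  have hs : ∑ k, b k ^ 2 = √(∑ k, b k ^ 2) ^ 2 := (Real.sq_sqrt (by positivity)).symm
  have hα' : 0 < √α := Real.sqrt_pos.2 hα
  rw [hη]
  calc _ ≤ √α / 8 * (√(∑ k, b k ^ 2) / √α * ∑ k, b k ^ 2) := by gcongr
    _ = 1 / 8 * √(∑ k, b k ^ 2) ^ 3 := by
        rw [pow_succ' _ 2, ← hs]; field_simp
    _ ≤ _ := by gcongr; norm_num

end Discrete

/-! ### Gaussian moments and Gaussian ensembles. -/

section Gaussian

open scoped NNReal

theorem integral_pow_four_gaussianReal (v : ℝ≥0) :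
    ∫ x, x ^ 4 ∂gaussianReal 0 v = 3 * (v : ℝ) ^ 2 := by
  have h0 : (0 : ℝ) ∈ interior (integrableExpSet id (gaussianReal 0 v)) := by
    simp [integrableExpSet_id_gaussianReal]
  have h := iteratedDeriv_mgf_zero h0 4
  -- Differentiating `q t * exp (v * t ^ 2 / 2)` replaces `q` by `q' + v * t * q`. Four rounds
  -- starting from `q = 1` give the fourth derivative of the moment generating function, read off at
  -- `0`.
  have hD : ∀ q q' : ℝ → ℝ, (∀ t, HasDerivAt q (q' t) t) →
      deriv (fun t => q t * Real.exp (v * t ^ 2 / 2)) =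
        fun t => (q' t + v * t * q t) * Real.exp (v * t ^ 2 / 2) := by
    intro q q' hq
    ext t
    have hE : HasDerivAt (fun t : ℝ => (v : ℝ) * t ^ 2 / 2) (v * t) t :=
      (((hasDerivAt_pow 2 t).const_mul (v : ℝ)).div_const 2).congr_deriv (by push_cast; ring)
    refine ((hq t).mul hE.exp).deriv.trans ?_
    ring
  have hm : mgf id (gaussianReal 0 v) = fun t => 1 * Real.exp (v * t ^ 2 / 2) := by
    rw [mgf_id_gaussianReal]; simp
  have e1 := hD (fun _ => 1) (fun _ => 0) fun t => hasDerivAt_const t 1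
  have e2 := hD (fun t => v * t) (fun _ => v) fun t => by
    simpa using (hasDerivAt_id t).const_mul (v : ℝ)
  have e3 := hD (fun t => v + v ^ 2 * t ^ 2) (fun t => 2 * v ^ 2 * t) fun t =>
    (((hasDerivAt_pow 2 t).const_mul ((v : ℝ) ^ 2)).const_add (v : ℝ)).congr_deriv
      (by push_cast; ring)
  have e4 := hD (fun t => 3 * v ^ 2 * t + v ^ 3 * t ^ 3) (fun t => 3 * v ^ 2 + 3 * v ^ 3 * t ^ 2)
    fun t => (((hasDerivAt_id t).const_mul (3 * (v : ℝ) ^ 2)).add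
      ((hasDerivAt_pow 3 t).const_mul ((v : ℝ) ^ 3))).congr_deriv (by push_cast; ring)
  have f1 : deriv (fun t : ℝ => 1 * Real.exp (v * t ^ 2 / 2)) =
      fun t => v * t * Real.exp (v * t ^ 2 / 2) := by rw [e1]; ext t; ring
  have f2 : deriv (fun t : ℝ => v * t * Real.exp (v * t ^ 2 / 2)) =
      fun t => (v + v ^ 2 * t ^ 2) * Real.exp (v * t ^ 2 / 2) := by rw [e2]; ext t; ring
  have f3 : deriv (fun t : ℝ => (v + v ^ 2 * t ^ 2) * Real.exp (v * t ^ 2 / 2)) =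
      fun t => (3 * v ^ 2 * t + v ^ 3 * t ^ 3) * Real.exp (v * t ^ 2 / 2) := by
    rw [e3]; ext t; ring
  rw [hm, iteratedDeriv_succ', f1, iteratedDeriv_succ', f2, iteratedDeriv_succ', f3,
    iteratedDeriv_succ', iteratedDeriv_zero, e4] at h
  simpa using h.symm

theorem integral_abs_pow_three_gaussianReal_le (v : ℝ≥0) :
    ∫ x, |x| ^ 3 ∂gaussianReal 0 v ≤ 2 * √v ^ 3 := by
  rcases eq_or_ne v 0 with rfl | hv
  · simp [gaussianReal_zero_var]
  have hs : 0 < √(v : ℝ) := Real.sqrt_pos.2 (by positivity)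
  set s := √(v : ℝ) with hsdef
  have hsv : (v : ℝ) = s ^ 2 := (Real.sq_sqrt v.coe_nonneg).symm
  have hm : ∀ q : ℝ≥0, MemLp id q (gaussianReal 0 v) := fun q => memLp_id_gaussianReal q
  have hI3 : Integrable (fun x => |x| ^ 3) (gaussianReal 0 v) :=
    integrable_abs_pow_three (F := id) (by exact_mod_cast hm 3)
  have hI2 : Integrable (fun x => x ^ 2) (gaussianReal 0 v) :=
    MemLp.integrable_sq (f := id) (by exact_mod_cast hm 2)
  have hI4 : Integrable (fun x => x ^ 4) (gaussianReal 0 v) := by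
    have h : MemLp id ((4 : ℕ) : ENNReal) (gaussianReal 0 v) := by exact_mod_cast hm 4
    have := h.integrable_norm_pow (by norm_num)
    simpa [Even.pow_abs (by decide : Even 4)] using this
  have h2 : ∫ x, x ^ 2 ∂gaussianReal 0 v = v := by
    have := variance_id_gaussianReal (μ := 0) (v := v)
    rwa [variance_of_integral_eq_zero aemeasurable_id (by simp [integral_id_gaussianReal])] at this
  -- The gap in this pointwise bound is a square over `2 * s`. With second moment `s ^ 2` and fourth
  -- moment `3 * s ^ 4`, the right side integrates to `2 * s ^ 3`.
  have h := integral_mono hI3 ((hI2.const_mul (s / 2)).add (hI4.const_mul (1 / (2 * s))))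
    fun x => show |x| ^ 3 ≤ s / 2 * x ^ 2 + 1 / (2 * s) * x ^ 4 by
      have e : s / 2 * x ^ 2 + 1 / (2 * s) * x ^ 4 - |x| ^ 3 =
          |x| ^ 2 * (s - |x|) ^ 2 / (2 * s) := by
        rw [← sq_abs x, ← Even.pow_abs (by decide : Even 4) x]
        field_simp
        ring
      have : 0 ≤ |x| ^ 2 * (s - |x|) ^ 2 / (2 * s) := by positivity
      linarith
  rw [integral_add' (hI2.const_mul _) (hI4.const_mul _), integral_const_mul, integral_const_mul,
    h2, integral_pow_four_gaussianReal, hsv] at h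
  refine h.trans (le_of_eq ?_)
  field_simp
  ring

/-- A centred linear combination is Gaussian with variance `∑ k, b k ^ 2`. Its third absolute moment
bound carries a factor `2`, and `η ^ 3 ≤ 1 / 8` turns this into exactly `1 / 4`. -/
theorem IsGaussianEnsemble.isHypercontractiveEnsemble {S : Type*} [MeasurableSpace S]
    {μ : Measure S} [IsProbabilityMeasure μ] {η : ℝ} (hη : 0 ≤ η) (hη' : η ≤ 1 / 2) {p : ℕ}
    {Z : Fin (p + 1) → S → ℝ} (hZ : IsGaussianEnsemble Z μ) :
    IsHypercontractiveEnsemble η Z μ := by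
  have hmeas : ∀ k : Fin p, Measurable (Z k.succ) := fun k => hZ.ensemble.measurable _
  refine ⟨hZ.ensemble, fun k => ?_, fun b => ?_⟩
  · refine Fin.cases ?_ (fun k => ?_) k
    · have : Z 0 = fun _ => 1 := funext hZ.ensemble.zero_eq_one
      rw [this]
      exact memLp_const 1
    · have h := memLp_id_gaussianReal (μ := 0) (v := 1) 3
      rw [← hZ.law k, memLp_map_measure_iff aestronglyMeasurable_id (hmeas k).aemeasurable] at h
      exact_mod_cast h
  · have hlaw : HasGaussianLaw (fun s => ∑ k, b k * Z k.succ s) μ := by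
      refine iIndepFun.hasGaussianLaw_fun_sum (X := fun k s => b k * Z k.succ s) (fun k => ?_)
        (hZ.indep.comp (fun k x => b k * x) fun k => measurable_const_mul (b k))
      have : HasGaussianLaw (Z k.succ) μ := ⟨by rw [hZ.law k]; infer_instance⟩
      exact this.fun_smul (b k)
    have hm : Measurable fun s => ∑ k, b k * Z k.succ s := by fun_prop
    have h := hlaw.map_eq_gaussianReal
    rw [variance_of_integral_eq_zero hm.aemeasurable (hZ.ensemble.integral_sum b),
      hZ.ensemble.integral_sum, hZ.ensemble.integral_sum_sq] at h
    have h3 := integral_abs_pow_three_gaussianReal_le (∑ k, b k ^ 2).toNNReal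
    rw [← h, integral_map hm.aemeasurable (by fun_prop),
      Real.coe_toNNReal _ (by positivity)] at h3
    have hη3 : η ^ 3 ≤ 1 / 8 := by
      calc η ^ 3 ≤ (1 / 2) ^ 3 := by gcongr
        _ = 1 / 8 := by norm_num
    calc _ ≤ 1 / 8 * (2 * √(∑ k, b k ^ 2) ^ 3) :=
          mul_le_mul hη3 h3 (integral_nonneg fun s => by positivity) (by norm_num)
      _ = _ := by ring

end Gaussian

/-! Independent coordinates. -/

section Independence

variable {S : Type*} [MeasurableSpace S] {μ : Measure S} {n ℓ p : ℕ}

variable {Ω : Type*} [MeasurableSpace Ω] {P : Measure (Fin ℓ → Ω)} [IsProbabilityMeasure P]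
  {X : S → Fin n → Fin ℓ → Ω} {𝒳 𝒢 : Fin ℓ → Fin n → Fin (p + 1) → S → ℝ}

theorem IsEnsembleCollection.map_coordinate (h : IsEnsembleCollection P X 𝒳 𝒢 μ) (i : Fin n) :
    μ.map (fun s => X s i) = P := by
  have e := (measurePreserving_eval (fun _ : Fin n => P) i).map_eq
  rw [← h.law, Measure.map_map (measurable_pi_apply i) h.measurable] at e
  exact e

variable [IsProbabilityMeasure μ] {Z : Fin ℓ → Fin n → Fin (p + 1) → S → ℝ}

/-- Independence is needed only across coordinates `i`: each coordinate keeps its joint law over all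
`j` and `k`, so dependence between steps survives the passage to the product space. -/
theorem map_family_eq_map_productFamily (hZ : ∀ j i k, Measurable (Z j i k))
    (hind : iIndepFun (fun i s j k => Z j i k s) μ) :
    μ.map (fun s i j k => Z j i k s) =
      (Measure.pi fun _ : Fin n => μ).map fun s i j k => productFamily Z j i k s := by
  have hW : ∀ i, Measurable fun s j k => Z j i k s := fun i =>
    measurable_pi_lambda _ fun j => measurable_pi_lambda _ fun k => hZ j i k
  rw [(iIndepFun_iff_map_fun_eq_pi_map fun i => (hW i).aemeasurable).1 hind]
  exact (Measure.pi_map_pi (μ := fun _ : Fin n => μ) (f := fun i s j k => Z j i k s)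
    fun i => (hW i).aemeasurable).symm

theorem integrable_and_integral_eq_productFamily (hZ : ∀ j i k, Measurable (Z j i k))
    (hind : iIndepFun (fun i s j k => Z j i k s) μ) {Ψ : (Fin ℓ → ℝ) → ℝ} (hΨ : Continuous Ψ)
    (Q : Fin ℓ → MultilinearPoly n p) :
    (Integrable (fun s => Ψ (evalTuple Q (productFamily Z) s)) (Measure.pi fun _ => μ) →
      Integrable (fun s => Ψ (evalTuple Q Z s)) μ) ∧
    ∫ s, Ψ (evalTuple Q Z s) ∂μ =
      ∫ s, Ψ (evalTuple Q (productFamily Z) s) ∂Measure.pi (fun _ => μ) := by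
  set Φ : (Fin n → Fin ℓ → Fin (p + 1) → ℝ) → ℝ := fun w => Ψ fun j => (Q j).eval fun i k => w i j k
  have hΦ : Measurable Φ := by
    refine hΨ.measurable.comp (measurable_pi_lambda _ fun j => ?_)
    unfold MultilinearPoly.eval
    fun_prop
  have hm : Measurable fun s i j k => Z j i k s :=
    measurable_pi_lambda _ fun i => measurable_pi_lambda _ fun j => measurable_pi_lambda _ fun k =>
      hZ j i k
  have hm' : Measurable fun (s : Fin n → S) i j k => productFamily Z j i k s :=
    measurable_pi_lambda _ fun i => measurable_pi_lambda _ fun j => measurable_pi_lambda _ fun k =>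
      (hZ j i k).comp (measurable_pi_apply i)
  have hmap := map_family_eq_map_productFamily hZ hind
  constructor
  · intro h
    have h' : Integrable Φ (μ.map fun s i j k => Z j i k s) := by
      rw [hmap, integrable_map_measure hΦ.aestronglyMeasurable hm'.aemeasurable]
      exact h
    exact (integrable_map_measure hΦ.aestronglyMeasurable hm.aemeasurable).1 h'
  · have h1 := integral_map hm.aemeasurable
      (hΦ.aestronglyMeasurable (μ := μ.map fun s i j k => Z j i k s))
    rw [hmap, integral_map hm'.aemeasurable hΦ.aestronglyMeasurable] at h1
    exact h1.symm

/-- All ensembles at coordinate `i`, over every step at once, are functions of the single variable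
`X s i`, and these variables are independent. -/
theorem IsEnsembleCollection.indep (h : IsEnsembleCollection P X 𝒳 𝒢 μ) :
    iIndepFun (fun i s j k => 𝒳 j i k s) μ := by
  have hm : ∀ i, Measurable fun s => X s i := fun i => (measurable_pi_apply i).comp h.measurable
  have hX : iIndepFun (fun i s => X s i) μ := by
    rw [iIndepFun_iff_map_fun_eq_pi_map fun i => (hm i).aemeasurable]
    simp only [h.map_coordinate]
    exact h.law
  have hmem : ∀ j i k, ∃ f : Ω → ℝ, Measurable f ∧ 𝒳 j i k = f ∘ fun s => X s i j := by
    intro j i k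
    have : 𝒳 j i k ∈ L2Of (fun s => X s i j) μ :=
      (h.constructed j i).span_eq ▸ Submodule.subset_span (Set.mem_range_self k)
    exact this.1
  choose f hf h𝒳 using hmem
  have := hX.comp (fun i (ω : Fin ℓ → Ω) j k => f j i k (ω j)) fun i =>
    measurable_pi_lambda _ fun j => measurable_pi_lambda _ fun k =>
      (hf j i k).comp (measurable_pi_apply j)
  convert this using 5 with i s j k
  rw [h𝒳]
  rfl

end Independence

/-! The total influence. -/

/-- Each squared coefficient is counted once per nonzero position of its tuple, hence at most `d`
times, and the constant term not at all. -/
theorem MultilinearPoly.sum_influence_le {n p : ℕ} {P : MultilinearPoly n p} {d : ℕ}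
    (hd : P.degree ≤ (d : WithBot ℕ)) : ∑ i, P.influence i ≤ d * P.variance := by
  have h1 : ∑ i, P.influence i = ∑ σ, (tupleDegree σ : ℝ) * P.coeff σ ^ 2 := by
    simp only [influence, Finset.sum_filter]
    rw [Finset.sum_comm]
    refine Finset.sum_congr rfl fun σ _ => ?_
    rw [← Finset.sum_filter, Finset.sum_const, nsmul_eq_mul, tupleDegree]
  have h2 : P.variance = ∑ σ ∈ Finset.univ.erase 0, P.coeff σ ^ 2 := by
    rw [variance, secondMoment, mean, ← Finset.add_sum_erase _ _ (Finset.mem_univ 0)]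
    ring
  rw [h1, h2, ← Finset.add_sum_erase _ _ (Finset.mem_univ 0), Finset.mul_sum]
  simp only [tupleDegree, Pi.zero_apply, ne_eq, not_true_eq_false, Finset.filter_false,
    Finset.card_empty, Nat.cast_zero, zero_mul, zero_add]
  refine Finset.sum_le_sum fun σ _ => ?_
  rcases eq_or_ne (P.coeff σ) 0 with h0 | h0
  · simp [h0]
  · exact mul_le_mul_of_nonneg_right (by exact_mod_cast tupleDegree_le_of_degree_le hd σ h0)
      (sq_nonneg _)

/-- By Cauchy–Schwarz, two of the three factors give `ℓ * ∑ j, I j`, while the remaining one is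
bounded by `√ℓ * √τ`. Keeping one power of the sum of `I` allows summation over coordinates
afterwards. -/
theorem sum_sqrt_pow_three_le {ℓ : ℕ} {I : Fin ℓ → ℝ} (hI : ∀ j, 0 ≤ I j) {τ : ℝ}
    (hτ : ∑ j, I j ≤ τ) :
    (∑ j, √(I j)) ^ 3 ≤ √ℓ * ℓ * √τ * ∑ j, I j := by
  have hsq : (∑ j, √(I j)) ^ 2 ≤ ℓ * ∑ j, I j := by
    have := sq_sum_le_card_mul_sum_sq (s := Finset.univ) (f := fun j => √(I j))
    simpa [Real.sq_sqrt (hI _)] using this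
  have h0 : 0 ≤ ∑ j, I j := Finset.sum_nonneg fun j _ => hI j
  have h1 : ∑ j, √(I j) ≤ √ℓ * √τ := by
    rw [← Real.sqrt_mul (Nat.cast_nonneg _)]
    exact Real.le_sqrt_of_sq_le (hsq.trans (by gcongr))
  calc (∑ j, √(I j)) ^ 3 = (∑ j, √(I j)) * (∑ j, √(I j)) ^ 2 := by ring
    _ ≤ (√ℓ * √τ) * (ℓ * ∑ j, I j) := by gcongr
    _ = _ := by ring

end InvariancePrinciple

/-! ### The invariance principle: choice of `η` and assembly of the constants. -/

theorem theoremA {S Ω : Type*} [MeasurableSpace S] [MeasurableSpace Ω]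
    [Finite Ω] [DiscreteMeasurableSpace Ω] {n ℓ p : ℕ}
    -- the underlying probability space, the distribution `P` and its common marginal `π`
    (μ : Measure S) [IsProbabilityMeasure μ]
    (P : Measure (Fin ℓ → Ω)) [IsProbabilityMeasure P]
    (π : Measure Ω) [IsProbabilityMeasure π]
    (hπ : ∀ j : Fin ℓ, P.map (fun ω => ω j) = π)
    (α : ℝ) (hα : 0 < α) (hmin : ∀ x : Ω, α ≤ π.real {x})
    (X : S → Fin n → Fin ℓ → Ω) (𝒳 𝒢 : Fin ℓ → Fin n → Fin (p + 1) → S → ℝ)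
    (hcoll : IsEnsembleCollection P X 𝒳 𝒢 μ)
    (Q : Fin ℓ → MultilinearPoly n p)
    (d : ℕ) (τ : ℝ) (hτ : τ ∈ Set.Icc (0 : ℝ) 1)
    (hdeg : ∀ j, (Q j).degree ≤ (d : WithBot ℕ))
    (hvar : ∀ j, (Q j).variance ≤ 1)
    (hinf : ∀ i, ∑ j, (Q j).influence i ≤ τ)
    (B : ℝ) (hB : 0 ≤ B) (Ψ : (Fin ℓ → ℝ) → ℝ) (hΨ : IsBSmooth B Ψ) :
    Integrable (fun s => Ψ (evalTuple Q 𝒳 s)) μ ∧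
    Integrable (fun s => Ψ (evalTuple Q 𝒢 s)) μ ∧
    |∫ s, (Ψ (evalTuple Q 𝒳 s) - Ψ (evalTuple Q 𝒢 s)) ∂μ| ≤
      (ℓ : ℝ) ^ (5 / 2 : ℝ) * d * B / 3 * (8 / √α) ^ d * √τ := by
  -- This choice makes `(η⁻¹ ^ d) ^ 3` equal to `(8 / √α) ^ d`. A point mass is at most `1`, so `α ≤
  -- 1`, which yields `η ≤ 1 / 2`.
  obtain ⟨η, hη0, hη3⟩ := exists_nonneg_pow_three_eq (by positivity : 0 ≤ √α / 8)
  have hΩ : Nonempty Ω := π.nonempty_of_neZero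
  have hα1 : √α ≤ 1 :=
    Real.sqrt_le_one.2 ((hmin (Classical.arbitrary Ω)).trans measureReal_le_one)
  have hη' : η ≤ 1 / 2 := by
    refine le_of_pow_le_pow_left₀ three_ne_zero (by norm_num) ?_
    rw [hη3]
    linarith
  have hη : 0 < η := by
    refine lt_of_le_of_ne hη0 fun h => ?_
    rw [← h] at hη3
    have := Real.sqrt_pos.2 hα
    linarith
  have h𝒳 : ∀ j i, IsHypercontractiveEnsemble η (𝒳 j i) μ := fun j i => by
    refine (hcoll.constructed j i).isHypercontractiveEnsemble hα hmin hη3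
      ((measurable_pi_apply j).comp ((measurable_pi_apply i).comp hcoll.measurable)) ?_
    rw [← hπ j, ← hcoll.map_coordinate i]
    exact (Measure.map_map (g := fun ω : Fin ℓ → Ω => ω j) (measurable_pi_apply j)
      ((measurable_pi_apply i).comp hcoll.measurable)).symm
  have h𝒢 : ∀ j i, IsHypercontractiveEnsemble η (𝒢 j i) μ := fun j i =>
    ((hcoll.gaussian j).gaussian i).isHypercontractiveEnsemble hη0 hη'
  have hcov : ∀ i j j' (k k' : Fin p), ∫ s, 𝒳 j i k.succ s * 𝒳 j' i k'.succ s ∂μ =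
      ∫ s, 𝒢 j i k.succ s * 𝒢 j' i k'.succ s ∂μ := by
    intro i j j' k k'
    -- Ensemble elements other than the constant one are centred, so these covariances are plain
    -- second moments.
    have h := hcoll.cov_eq i i j j' k.succ k'.succ
    rw [covariance_eq_sub ((h𝒳 j i).ensemble.memLp_two _) ((h𝒳 j' i).ensemble.memLp_two _),
      covariance_eq_sub ((h𝒢 j i).ensemble.memLp_two _) ((h𝒢 j' i).ensemble.memLp_two _),
      (h𝒳 j i).ensemble.integral_succ, (h𝒢 j i).ensemble.integral_succ] at h
    simpa using h
  obtain ⟨hint𝒳, heq𝒳⟩ := integrable_and_integral_eq_productFamily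
    (fun j i k => (h𝒳 j i).ensemble.measurable k) hcoll.indep hΨ.contDiff.continuous Q
  obtain ⟨hint𝒢, heq𝒢⟩ := integrable_and_integral_eq_productFamily
    (fun j i k => (h𝒢 j i).ensemble.measurable k) hcoll.gaussian_indep hΨ.contDiff.continuous Q
  have hI𝒳 := hint𝒳 (integrable_comp_evalTuple hΨ h𝒳 Q)
  have hI𝒢 := hint𝒢 (integrable_comp_evalTuple hΨ h𝒢 Q)
  refine ⟨hI𝒳, hI𝒢, ?_⟩
  rw [integral_sub hI𝒳 hI𝒢, heq𝒳, heq𝒢]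
  refine (abs_integral_sub_le_sum hη hη' hB hΨ h𝒳 h𝒢 hdeg hcov).trans ?_
  have hK : ((η⁻¹) ^ d) ^ 3 = (8 / √α) ^ d := by
    rw [← pow_mul, mul_comm, pow_mul, inv_pow, hη3, inv_div]
  have hinf0 : ∀ j i, 0 ≤ (Q j).influence i := fun j i =>
    Finset.sum_nonneg fun σ _ => sq_nonneg _
  have htotal : ∑ i, ∑ j, (Q j).influence i ≤ ℓ * d := by
    rw [Finset.sum_comm]
    calc _ ≤ ∑ _j : Fin ℓ, (d : ℝ) := Finset.sum_le_sum fun j _ =>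
          (MultilinearPoly.sum_influence_le (hdeg j)).trans
            (mul_le_of_le_one_right (Nat.cast_nonneg d) (hvar j))
      _ = _ := by simp
  have hℓ : (ℓ : ℝ) ^ (5 / 2 : ℝ) = √ℓ * ℓ * ℓ := by
    have : (5 / 2 : ℝ) = 1 / 2 + (2 : ℕ) := by norm_num
    rw [this, Real.rpow_add_of_nonneg (Nat.cast_nonneg _) (by norm_num) (by norm_num),
      Real.rpow_natCast, ← Real.sqrt_eq_rpow]
    ring
  calc _ = ∑ i, B / 3 * (8 / √α) ^ d * (∑ j, √((Q j).influence i)) ^ 3 :=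
        Finset.sum_congr rfl fun i _ => by rw [mul_pow, hK, mul_assoc]
    _ ≤ ∑ i, B / 3 * (8 / √α) ^ d * (√ℓ * ℓ * √τ * ∑ j, (Q j).influence i) :=
        Finset.sum_le_sum fun i _ => mul_le_mul_of_nonneg_left
          (sum_sqrt_pow_three_le (fun j => hinf0 j i) (hinf i)) (by positivity)
    _ = B / 3 * (8 / √α) ^ d * (√ℓ * ℓ * √τ) * ∑ i, ∑ j, (Q j).influence i := by
        rw [Finset.mul_sum]
        exact Finset.sum_congr rfl fun i _ => by ring
    _ ≤ B / 3 * (8 / √α) ^ d * (√ℓ * ℓ * √τ) * (ℓ * d) := by gcongr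
    _ = _ := by rw [hℓ]; ring
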